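/- Let $D\subset\mathbb{C}^n$ be a bounded open set with Lipschitz boundary (not necessarily connected), let $0\le p,q\le n$, and let $s$ be an integer. Notation. For real $t$, $W^t(\mathbb{C}^n)$ is the space of tempered distributions $u$ with $\|u\|_{W^t}^2=\int|\hat u(\xi)|^2(1+|\xi|^2)^t\,dV(\xi)<\infty$. Let $W^t_{p,q}(\overline D)$ be the space of restrictions to $D$ of $(p,q)$-currents on $\mathbb{C}^n$ with coefficients in $W^t(\mathbb{C}^n)$, normed by the infimum of the norms of the extensions. Let $(W^t_0)_{p,q}(\overline D)$ be the space of $(p,q)$-currents on $\mathbb{C}^n$ with coefficients in $W^t(\mathbb{C}^n)$ and support in $\overline D$, with the norm of $W^t$. All these spaces are $0$ if $q>n$. Put $$Z^{p,q}_{W^t}(D)=\{u\in W^t_{p,q}(\overline D):\overline\partial u=0 \text{ on } D\},\qquad B^{p,q}_{W^t}(D)=\{\overline\partial u\in W^t_{p,q}(\overline D): u\in W^t_{p,q-1}(\overline D)\},$$ where $\overline\partial$ is taken in the sense of distributions on $D$, and $$Z^{p,q}_{c,W^t}(D)=\{u\in (W^t_0)_{p,q}(\overline D):\overline\partial u=0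 \text{ on }\mathbb{C}^n\},\qquad B^{p,q}_{c,W^t}(D)=\{\overline\partial u\in (W^t_0)_{p,q}(\overline D): u\in (W^t_0)_{p,q-1}(\overline D)\},$$ where $\overline\partial$ is taken in the sense of distributions on $\mathbb{C}^n$ (for $q=0$ both spaces $B$ are $0$). Let $H^{p,q}_{W^t}(D)=Z^{p,q}_{W^t}(D)/B^{p,q}_{W^t}(D)$ and $H^{p,q}_{c,W^t}(D)=Z^{p,q}_{c,W^t}(D)/B^{p,q}_{c,W^t}(D)$, with the quotient semi-norms and quotient topologies. For a semi-normed space $H$ let $\mathrm{Red}\,H$ be the normed space $H/\{x:\|x\|=0\}$. A continuous bilinear map $\beta:X\times Y\to\mathbb{C}$ of Banach spaces is perfect if for every $\phi\in X^*$ there is a unique $y\in Y$ with $\phi=\beta(\cdot,y)$, and for every $\psi\in Y^*$ there is a unique $x\in X$ with $\psi=\beta(x,\cdot)$. Then: 1. $H^{p,q}_{W^s}(D)$ is Hausdorff if and only if $H^{n-p,n-q+1}_{c,W^{-s}}(D)$ is Hausdorff. 2. The pairing $(f,g)\mapsto\int_D f\wedge g$ of $(p,q)$-forms $f$ smooth up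 to the boundary of $D$ and smooth $(n-p,n-q)$-forms $g$ with compact support in $D$ extends uniquely to a continuous bilinear map $W^s_{p,q}(\overline D)\times(W^{-s}_0)_{n-p,n-q}(\overline D)\to\mathbb{C}$, again written $\int_D f\wedge g$. The formula $([f],[g])\mapsto\int_D f\wedge g$, for $f\in Z^{p,q}_{W^s}(D)$ and $g\in Z^{n-p,n-q}_{c,W^{-s}}(D)$, gives a well-defined continuous bilinear map $$\mathrm{Red}\,H^{p,q}_{W^s}(D)\times \mathrm{Red}\,H^{n-p,n-q}_{c,W^{-s}}(D)\to\mathbb{C}$$ of Banach spaces, and this map is perfect. -/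

import Mathlib

open MeasureTheory TemperedDistribution
open scoped SchwartzMap LineDeriv

noncomputable section

namespace SobolevDolbeault

/-- `ℂⁿ` with its Euclidean norm, Lebesgue measure and underlying real inner product. -/
abbrev Cn (n : ℕ) : Type := EuclideanSpace ℂ (Fin n)

/-! ### Sobolev spaces on `ℂⁿ` -/

/-- The tempered distributions `u` on `ℂⁿ` with `(1 + |ξ|²)^{s/2} û ∈ L²`, as a subspace. -/
def sobolevSubmodule (n : ℕ) (s : ℝ) : Submodule ℂ 𝓢'(Cn n, ℂ) where
  carrier := {u | MemSobolev s 2 u}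
  add_mem' hu hv := hu.add hv
  zero_mem' := memSobolev_fun_zero (Cn n) ℂ s 2
  smul_mem' c _ hu := hu.smul c

/-- The Sobolev space `W^s(ℂⁿ)`; a separate type, since its topology is that of the Sobolev norm
and not the one inherited from the space of tempered distributions. -/
def Sobolev (n : ℕ) (s : ℝ) : Type := sobolevSubmodule n s

instance (n : ℕ) (s : ℝ) : AddCommGroup (Sobolev n s) :=
  inferInstanceAs (AddCommGroup (sobolevSubmodule n s))

instance (n : ℕ) (s : ℝ) : Module ℂ (Sobolev n s) :=
  inferInstanceAs (Module ℂ (sobolevSubmodule n s))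

/-- The tempered distribution underlying an element of `W^s(ℂⁿ)`. -/
def Sobolev.dist {n : ℕ} {s : ℝ} : Sobolev n s →ₗ[ℂ] 𝓢'(Cn n, ℂ) :=
  (sobolevSubmodule n s).subtype

theorem lp_dist_injective {n : ℕ} {f g : Lp ℂ 2 (volume : Measure (Cn n))}
    (h : (f : 𝓢'(Cn n, ℂ)) = (g : 𝓢'(Cn n, ℂ))) : f = g := by
  have hk := Lp.ker_toTemperedDistributionCLM_eq_bot (E := Cn n) (F := ℂ) (p := 2)
    (μ := (volume : Measure (Cn n)))
  exact LinearMap.ker_eq_bot.mp hk h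

/-- The `L²` function `(1 + |ξ|²)^{s/2} û`, taken back to the physical side by the (unitary)
inverse Fourier transform. -/
def Sobolev.toL2 {n : ℕ} {s : ℝ} : Sobolev n s →ₗ[ℂ] Lp ℂ 2 (volume : Measure (Cn n)) where
  toFun u := u.2.choose
  map_add' u v := by
    apply lp_dist_injective
    rw [← (u + v).2.choose_spec, ← Lp.toTemperedDistributionCLM_apply, map_add,
      Lp.toTemperedDistributionCLM_apply, Lp.toTemperedDistributionCLM_apply,
      ← u.2.choose_spec, ← v.2.choose_spec, ← map_add]
    rfl
  map_smul' c u := by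
    apply lp_dist_injective
    rw [← (c • u).2.choose_spec, ← Lp.toTemperedDistributionCLM_apply, map_smul,
      Lp.toTemperedDistributionCLM_apply, RingHom.id_apply, ← u.2.choose_spec, ← map_smul]
    rfl

theorem Sobolev.besselPotential_dist {n : ℕ} {s : ℝ} (u : Sobolev n s) :
    besselPotential (Cn n) ℂ s u.dist = (u.toL2 : 𝓢'(Cn n, ℂ)) :=
  u.2.choose_spec

theorem Sobolev.toL2_injective {n : ℕ} {s : ℝ} :
    Function.Injective (Sobolev.toL2 : Sobolev n s →ₗ[ℂ] _) := by
  intro u v h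
  have h1 : besselPotential (Cn n) ℂ s u.dist = besselPotential (Cn n) ℂ s v.dist := by
    rw [u.besselPotential_dist, v.besselPotential_dist, h]
  have h2 := congrArg (besselPotential (Cn n) ℂ (-s)) h1
  simp only [besselPotential_besselPotential_apply, add_neg_cancel, besselPotential_zero,
    ContinuousLinearMap.id_apply] at h2
  exact Subtype.ext h2

/-- The Sobolev norm `‖u‖² = ∫ |û|² (1 + |ξ|²)^s dξ`, i.e. the `L²` norm of `(1 + |ξ|²)^{s/2} û`. -/
instance (n : ℕ) (s : ℝ) : NormedAddCommGroup (Sobolev n s) :=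
  NormedAddCommGroup.induced _ _ (Sobolev.toL2 : Sobolev n s →ₗ[ℂ] _) Sobolev.toL2_injective

instance (n : ℕ) (s : ℝ) : NormedSpace ℂ (Sobolev n s) :=
  NormedSpace.induced ℂ _ _ (Sobolev.toL2 : Sobolev n s →ₗ[ℂ] _)

/-- A Schwartz function as an element of `W^s(ℂⁿ)`. -/
def Sobolev.ofSchwartz {n : ℕ} (s : ℝ) (f : 𝓢(Cn n, ℂ)) : Sobolev n s :=
  ⟨SchwartzMap.toTemperedDistributionCLM (Cn n) ℂ volume f, f.memSobolev⟩

/-! ### Forms, currents and the `∂̄` operator -/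

/-- Index set for the coefficients of `(p,q)`-forms `∑ u_{I,J} dz_I ∧ dz̄_J`, where `I` and `J` are
increasing multi-indices of lengths `p` and `q`, i.e. subsets of these cardinalities. -/
abbrev FormIdx (n p q : ℕ) : Type :=
  {I : Finset (Fin n) // I.card = p} × {J : Finset (Fin n) // J.card = q}

/-- `(p,q)`-currents on `ℂⁿ` with tempered coefficients. -/
abbrev Current (n p q : ℕ) : Type := FormIdx n p q → 𝓢'(Cn n, ℂ)

/-- `∂u/∂z̄_j = ½ (∂u/∂x_j + i ∂u/∂y_j)` in the sense of distributions. -/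
def dzbar {n : ℕ} (j : Fin n) : 𝓢'(Cn n, ℂ) →ₗ[ℂ] 𝓢'(Cn n, ℂ) :=
  (1 / 2 : ℂ) •
    ((LineDeriv.lineDerivOpCLM ℂ 𝓢'(Cn n, ℂ) (EuclideanSpace.single j (1 : ℂ))).toLinearMap +
      Complex.I •
        (LineDeriv.lineDerivOpCLM ℂ 𝓢'(Cn n, ℂ)
          (EuclideanSpace.single j Complex.I)).toLinearMap)

/-- The index `(I, K ∖ {j})` for `j ∈ K`. -/
def FormIdx.erase {n p q : ℕ} (a : FormIdx n p (q + 1)) (j : {j : Fin n // j ∈ a.2.1}) :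
    FormIdx n p q :=
  (a.1, ⟨a.2.1.erase j.1, by rw [Finset.card_erase_of_mem j.2, a.2.2]; rfl⟩)

/-- `∂̄` on currents:
`∂̄ (∑ u_{I,J} dz_I ∧ dz̄_J) = ∑ ∑_j (∂u_{I,J}/∂z̄_j) dz̄_j ∧ dz_I ∧ dz̄_J`, so that
`(∂̄u)_{I,K} = (-1)^p ∑_{j ∈ K} (-1)^{#{k ∈ K : k < j}} ∂u_{I, K ∖ {j}}/∂z̄_j`. -/
def dbar {n p q : ℕ} : Current n p q →ₗ[ℂ] Current n p (q + 1) :=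
  LinearMap.pi fun a =>
    ((-1 : ℂ) ^ p) • ∑ j : {j : Fin n // j ∈ a.2.1},
      ((-1 : ℂ) ^ (a.2.1.filter (fun k => k < j.1)).card) •
        (dzbar j.1 ∘ₗ LinearMap.proj (a.erase j))

/-- The currents all of whose coefficients vanish on the set `S`. -/
def vanishingOn (n p q : ℕ) (S : Set (Cn n)) : Submodule ℂ (Current n p q) where
  carrier := {u | ∀ a, Distribution.IsVanishingOn (u a) S}
  add_mem' hu hv a φ hφ := by
    have h1 := hu a φ hφ
    have h2 := hv a φ hφ
    exact (congrArg₂ (· + ·) h1 h2).trans (add_zero 0)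
  zero_mem' a φ hφ := rfl
  smul_mem' c u hu a φ hφ := by
    have h1 := hu a φ hφ
    exact (congrArg (c • ·) h1).trans (smul_zero c)

/-- `(p,q)`-currents on `ℂⁿ` with coefficients in `W^s(ℂⁿ)`, normed by the square root of the sum of
the squared norms of the coefficients. -/
abbrev SobolevForm (n : ℕ) (s : ℝ) (p q : ℕ) : Type :=
  PiLp 2 (fun _ : FormIdx n p q => Sobolev n s)

/-- The current underlying a form with coefficients in `W^s(ℂⁿ)`. -/
def SobolevForm.current {n : ℕ} {s : ℝ} {p q : ℕ} :
    SobolevForm n s p q →ₗ[ℂ] Current n p q :=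
  LinearMap.pi fun a => Sobolev.dist ∘ₗ (PiLp.projₗ 2 (fun _ : FormIdx n p q => Sobolev n s) a)

/-- A form with Schwartz coefficients as a form with coefficients in `W^s(ℂⁿ)`. -/
def SobolevForm.ofSchwartz {n : ℕ} (s : ℝ) {p q : ℕ} (f : FormIdx n p q → 𝓢(Cn n, ℂ)) :
    SobolevForm n s p q :=
  WithLp.toLp 2 fun a => Sobolev.ofSchwartz s (f a)

/-! ### Sobolev spaces of forms on a domain -/

/-- `W^s_{p,q}(D̄)`: restrictions to `D` of forms with coefficients in `W^s(ℂⁿ)`. Two such forms are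
identified when they have the same restriction to `D`, and the norm of a restriction is the infimum
of the norms of its extensions (the quotient norm). -/
abbrev SobolevFormOn (n : ℕ) (s : ℝ) (D : Set (Cn n)) (p q : ℕ) : Type :=
  SobolevForm n s p q ⧸ (vanishingOn n p q D).comap SobolevForm.current

/-- `(W^s_0)_{p,q}(D̄)`: forms with coefficients in `W^s(ℂⁿ)` and support in `D̄`, i.e. vanishing on
`ℂⁿ ∖ D̄`, with the norm of `W^s(ℂⁿ)`. -/
abbrev SobolevFormSupp (n : ℕ) (s : ℝ) (D : Set (Cn n)) (p q : ℕ) : Type :=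
  ((vanishingOn n p q (closure D)ᶜ).comap
    (SobolevForm.current : SobolevForm n s p q →ₗ[ℂ] Current n p q) :
      Submodule ℂ (SobolevForm n s p q))

/-- Restriction to `D`. -/
abbrev restrict {n : ℕ} {s : ℝ} {p q : ℕ} (D : Set (Cn n)) :
    SobolevForm n s p q →ₗ[ℂ] SobolevFormOn n s D p q :=
  Submodule.mkQ ((vanishingOn n p q D).comap SobolevForm.current)

/-! ### Cohomology of a sequence of unbounded operators

A sequence of partially defined linear operators `X q ⇢ X (q + 1)` is given by their graphs. -/

section Complex

variable {X : ℕ → Type} [∀ q, SeminormedAddCommGroup (X q)] [∀ q, NormedSpace ℂ (X q)]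

/-- The kernel of the operator in degree `q`. On it the graph norm equals the norm of `X q`. -/
def cocycles (Γ : ∀ q, Submodule ℂ (X q × X (q + 1))) (q : ℕ) : Submodule ℂ (X q) :=
  (Γ q).comap (LinearMap.inl ℂ (X q) (X (q + 1)))

/-- The range in `X q` of the operator in degree `q - 1` (zero if `q = 0`). -/
def coboundaries (Γ : ∀ q, Submodule ℂ (X q × X (q + 1))) : ∀ q : ℕ, Submodule ℂ (X q)
  | 0 => ⊥
  | q + 1 => (Γ q).map (LinearMap.snd ℂ (X q) (X (q + 1)))

/-- Cocycles modulo coboundaries, with the quotient semi-norm and quotient topology. -/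
def Cohomology (Γ : ∀ q, Submodule ℂ (X q × X (q + 1))) (q : ℕ) : Type :=
  cocycles Γ q ⧸ (coboundaries Γ q).submoduleOf (cocycles Γ q)

instance (Γ : ∀ q, Submodule ℂ (X q × X (q + 1))) (q : ℕ) :
    SeminormedAddCommGroup (Cohomology Γ q) :=
  inferInstanceAs (SeminormedAddCommGroup
    (cocycles Γ q ⧸ (coboundaries Γ q).submoduleOf (cocycles Γ q)))

instance (Γ : ∀ q, Submodule ℂ (X q × X (q + 1))) (q : ℕ) : NormedSpace ℂ (Cohomology Γ q) :=
  inferInstanceAs (NormedSpace ℂ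
    (cocycles Γ q ⧸ (coboundaries Γ q).submoduleOf (cocycles Γ q)))

/-- Reduced cohomology: the quotient of the cohomology by the subspace of elements of semi-norm
zero (its indiscrete part). -/
def RedCohomology (Γ : ∀ q, Submodule ℂ (X q × X (q + 1))) (q : ℕ) : Type :=
  SeparationQuotient (Cohomology Γ q)

instance (Γ : ∀ q, Submodule ℂ (X q × X (q + 1))) (q : ℕ) :
    NormedAddCommGroup (RedCohomology Γ q) :=
  inferInstanceAs (NormedAddCommGroup (SeparationQuotient (Cohomology Γ q)))

instance (Γ : ∀ q, Submodule ℂ (X q × X (q + 1))) (q : ℕ) : NormedSpace ℂ (RedCohomology Γ q) :=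
  inferInstanceAs (NormedSpace ℂ (SeparationQuotient (Cohomology Γ q)))

/-- The cohomology class of a cocycle. -/
def cohomologyClass (Γ : ∀ q, Submodule ℂ (X q × X (q + 1))) {q : ℕ} (f : cocycles Γ q) :
    Cohomology Γ q :=
  Submodule.Quotient.mk (p := (coboundaries Γ q).submoduleOf (cocycles Γ q)) f

/-- The reduced cohomology class of a cocycle. -/
def redClass (Γ : ∀ q, Submodule ℂ (X q × X (q + 1))) {q : ℕ} (f : cocycles Γ q) :
    RedCohomology Γ q :=
  SeparationQuotient.mk (cohomologyClass Γ f)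

end Complex

/-! ### The maximal and minimal realizations -/

/-- The graph of the maximal `W^s`-realization of `∂̄` on `D`: pairs `(u, v)` with
`u ∈ W^s_{p,q}(D̄)`, `v ∈ W^s_{p,q+1}(D̄)` and `∂̄u = v` on `D` in the sense of distributions. -/
def maxGraph (n : ℕ) (s : ℝ) (D : Set (Cn n)) (p q : ℕ) :
    Submodule ℂ (SobolevFormOn n s D p q × SobolevFormOn n s D p (q + 1)) :=
  ((vanishingOn n p (q + 1) D).comap
    (dbar ∘ₗ SobolevForm.current ∘ₗ
        LinearMap.fst ℂ (SobolevForm n s p q) (SobolevForm n s p (q + 1)) -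
      SobolevForm.current ∘ₗ
        LinearMap.snd ℂ (SobolevForm n s p q) (SobolevForm n s p (q + 1)))).map
    (LinearMap.prodMap (restrict D) (restrict D))

/-- The graph of the minimal `W^s`-realization of `∂̄` on `D`: pairs `(u, v)` of forms on `ℂⁿ` with
coefficients in `W^s(ℂⁿ)` supported in `D̄` such that `∂̄u = v` on `ℂⁿ`. -/
def minGraph (n : ℕ) (s : ℝ) (D : Set (Cn n)) (p q : ℕ) :
    Submodule ℂ (SobolevFormSupp n s D p q × SobolevFormSupp n s D p (q + 1)) :=
  LinearMap.ker
    (dbar ∘ₗ SobolevForm.current ∘ₗ Submodule.subtype _ ∘ₗ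
        LinearMap.fst ℂ (SobolevFormSupp n s D p q) (SobolevFormSupp n s D p (q + 1)) -
      SobolevForm.current ∘ₗ Submodule.subtype _ ∘ₗ
        LinearMap.snd ℂ (SobolevFormSupp n s D p q) (SobolevFormSupp n s D p (q + 1)))

/-- `Z^{p,q}_{W^s}(D)`. -/
abbrev Zmax (n : ℕ) (s : ℝ) (D : Set (Cn n)) (p q : ℕ) :
    Submodule ℂ (SobolevFormOn n s D p q) :=
  cocycles (maxGraph n s D p) q

/-- `Z^{p,q}_{c,W^s}(D)`. -/
abbrev Zmin (n : ℕ) (s : ℝ) (D : Set (Cn n)) (p q : ℕ) :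
    Submodule ℂ (SobolevFormSupp n s D p q) :=
  cocycles (minGraph n s D p) q

/-- `H^{p,q}_{W^s}(D)`. -/
abbrev Hmax (n : ℕ) (s : ℝ) (D : Set (Cn n)) (p q : ℕ) : Type :=
  Cohomology (maxGraph n s D p) q

/-- `H^{p,q}_{c,W^s}(D)`. -/
abbrev Hmin (n : ℕ) (s : ℝ) (D : Set (Cn n)) (p q : ℕ) : Type :=
  Cohomology (minGraph n s D p) q

/-- `Red H^{p,q}_{W^s}(D)`. -/
abbrev RedHmax (n : ℕ) (s : ℝ) (D : Set (Cn n)) (p q : ℕ) : Type :=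
  RedCohomology (maxGraph n s D p) q

/-- `Red H^{p,q}_{c,W^s}(D)`. -/
abbrev RedHmin (n : ℕ) (s : ℝ) (D : Set (Cn n)) (p q : ℕ) : Type :=
  RedCohomology (minGraph n s D p) q

/-! ### The pairing `∫_D f ∧ g` -/

/-- The sign `ε` with `dz_I ∧ dz_{Iᶜ} = ε dz_1 ∧ ⋯ ∧ dz_n`. -/
def shuffleSign {n : ℕ} (I : Finset (Fin n)) : ℂ :=
  (-1) ^ ((I ×ˢ Iᶜ).filter (fun x => x.2 < x.1)).card

/-- The index `(Iᶜ, Jᶜ)`. -/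
def FormIdx.compl {n p q : ℕ} (a : FormIdx n p q) : FormIdx n (n - p) (n - q) :=
  (⟨a.1.1ᶜ, by rw [Finset.card_compl, Fintype.card_fin, a.1.2]⟩,
    ⟨a.2.1ᶜ, by rw [Finset.card_compl, Fintype.card_fin, a.2.2]⟩)

/-- `∫_D f ∧ g` for a `(p,q)`-form `f` and an `(n-p,n-q)`-form `g`. The `(I,J)`-coefficient of `f` and
the `(Iᶜ,Jᶜ)`-coefficient of `g` contribute
`dz_I ∧ dz̄_J ∧ dz_{Iᶜ} ∧ dz̄_{Jᶜ} = (-1)^{q(n-p)} ε_I ε_J dz_1 ∧ ⋯ ∧ dz_n ∧ dz̄_1 ∧ ⋯ ∧ dz̄_n`, and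
`dz_1 ∧ ⋯ ∧ dz_n ∧ dz̄_1 ∧ ⋯ ∧ dz̄_n = (-1)^{n(n-1)/2} (-2i)^n dV`. -/
def integralWedge {n p q : ℕ} (D : Set (Cn n)) (f : FormIdx n p q → 𝓢(Cn n, ℂ))
    (g : FormIdx n (n - p) (n - q) → 𝓢(Cn n, ℂ)) : ℂ :=
  (-1) ^ (n * (n - 1) / 2) * (-2 * Complex.I) ^ n *
    ∑ a : FormIdx n p q, (-1) ^ (q * (n - p)) * shuffleSign a.1.1 * shuffleSign a.2.1 *
      ∫ z in D, f a z * g a.compl z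

/-- `B` is a continuous bilinear extension to `W^s_{p,q}(D̄) × (W^{-s}_0)_{n-p,n-q}(D̄)` of the pairing
`(f, g) ↦ ∫_D f ∧ g` of forms `f` smooth up to the boundary of `D` (for bounded `D` these are the
restrictions of Schwartz forms) and smooth forms `g` with support in `D`. -/
def ExtendsIntegralWedge {n : ℕ} {s : ℝ} {D : Set (Cn n)} {p q : ℕ}
    (B : SobolevFormOn n s D p q →L[ℂ] SobolevFormSupp n (-s) D (n - p) (n - q) →L[ℂ] ℂ) : Prop :=
  ∀ (f : FormIdx n p q → 𝓢(Cn n, ℂ)) (g : FormIdx n (n - p) (n - q) → 𝓢(Cn n, ℂ)),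
    (∀ a, tsupport (g a) ⊆ D) →
    ∀ G : SobolevFormSupp n (-s) D (n - p) (n - q),
      (G : SobolevForm n (-s) (n - p) (n - q)) = SobolevForm.ofSchwartz (-s) g →
      B (restrict D (SobolevForm.ofSchwartz s f)) G = integralWedge D f g

/-- A continuous bilinear map `β : X × Y → ℂ` is perfect if every continuous linear functional on
`X` is `β(·, y)` for a unique `y`, and every one on `Y` is `β(x, ·)` for a unique `x`. -/
def IsPerfect (X Y : Type) [NormedAddCommGroup X] [NormedSpace ℂ X] [NormedAddCommGroup Y]
    [NormedSpace ℂ Y] (β : X →L[ℂ] Y →L[ℂ] ℂ) : Prop :=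
  (∀ φ : X →L[ℂ] ℂ, ∃! y : Y, ∀ x, φ x = β x y) ∧
    ∀ ψ : Y →L[ℂ] ℂ, ∃! x : X, ∀ y, ψ y = β x y

/-! ### Lipschitz boundary -/

/-- Near each boundary point `x`, and for suitable orthogonal real coordinates with last axis `v`,
the set `D` is the region strictly below the graph of a Lipschitz function of the remaining
coordinates `y - ⟪v, y⟫ v`. -/
def HasLipschitzBoundary {n : ℕ} (D : Set (Cn n)) : Prop :=
  ∀ x ∈ frontier D, ∃ (U : Set (Cn n)) (v : Cn n) (φ : Cn n → ℝ) (K : NNReal),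
    IsOpen U ∧ x ∈ U ∧ ‖v‖ = 1 ∧ LipschitzWith K φ ∧
      ∀ y ∈ U, y ∈ D ↔ inner ℝ v y < φ (y - inner ℝ v y • v)

end SobolevDolbeault

end

/-! ### Closed range theorem for linear relations -/

noncomputable section
namespace SobolevDolbeault

/-! By Plancherel, `∫ u v` identifies `W^{-s}(ℂⁿ)` with the dual of `W^s(ℂⁿ)`, and the wedge product
does the same for forms, coefficient by coefficient, up to nonzero constants. The dual of the
quotient `W^s(D̄)` is then the annihilator in `W^{-s}` of the forms vanishing on `D`. Testing
against forms supported off `D̄` shows that this annihilator consists of forms supported in `D̄`.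
That it contains all of them is where the boundary matters: a form supported in `D̄` is cut up by a
partition of unity, each piece is pushed into `D` by a small translation along the Lipschitz axis,
and the translation is undone in a limit. So `W^s(D̄)` and `W^{-s}_0(D̄)` are duals of each other
(`exists_domainPairing`, `domainPairing_represents`).

The same pushing argument proves Green's formula without boundary term (`Sobolev.green`). On `ℂⁿ` it
is an identity of Fourier transforms; on `D` the translated pieces have compact support in `D`,
where a cutoff reduces to `ℂⁿ`. Since `∂̄` is its own transpose up to sign
(`sum_dop_dbarCoef_wedgeSign`), Green's formula makes the maximal realization of `∂̄` in `W^s` and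
the minimal one in `W^{-s}` annihilate each other, and testing with single-coefficient Schwartz
forms shows that each graph is the whole adjoint of the other (`mem_maxGraph_iff`,
`mem_minGraph_iff`).

The rest is functional analysis. The closed range theorem (`isClosed_range_iff`) gives the Hausdorff
equivalence, as a quotient `Z / B` with `Z` closed is Hausdorff exactly when `B` is closed. For the
pairing, each space of cocycles is the annihilator of the opposite coboundaries, and Hahn–Banach
turns this into a perfect pairing of `Z` modulo the closure of `B` with `Z'` modulo the closure of
`B'` (`exists_perfect_pairing`). -/

theorem exists_functional_of_notMem_closure {E : Type*} [NormedAddCommGroup E] [NormedSpace ℂ E]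
    (S : Submodule ℂ E) {x : E} (hx : x ∉ S.topologicalClosure) :
    ∃ f : E →L[ℂ] ℂ, (∀ y ∈ S, f y = 0) ∧ f x ≠ 0 := by
  have : IsClosed (S.topologicalClosure : Set E) := S.isClosed_topologicalClosure
  have h0 : S.topologicalClosure.mkQ x ≠ 0 := by
    rwa [Ne, Submodule.mkQ_apply, Submodule.Quotient.mk_eq_zero]
  obtain ⟨f, hf⟩ := SeparatingDual.exists_ne_zero (R := ℂ) h0
  refine ⟨f.comp S.topologicalClosure.mkQL, fun y hy => ?_, hf⟩
  have : S.topologicalClosure.mkQ y = 0 := by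
    rw [Submodule.mkQ_apply, Submodule.Quotient.mk_eq_zero]
    exact S.le_topologicalClosure hy
  change f (S.topologicalClosure.mkQ y) = 0
  rw [this, map_zero]

/-- A continuous bilinear map through which all functionals on either factor are represented. -/
structure Represents {X Y : Type*} [NormedAddCommGroup X] [NormedSpace ℂ X] [NormedAddCommGroup Y]
    [NormedSpace ℂ Y] (P : X →L[ℂ] Y →L[ℂ] ℂ) : Prop where
  left : ∀ φ : X →L[ℂ] ℂ, ∃ y, ∀ x, φ x = P x y
  right : ∀ ψ : Y →L[ℂ] ℂ, ∃ x, ∀ y, ψ y = P x y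

section

variable {X Y X₁ Y₁ : Type*} [NormedAddCommGroup X] [NormedSpace ℂ X] [NormedAddCommGroup Y]
  [NormedSpace ℂ Y] [NormedAddCommGroup X₁] [NormedSpace ℂ X₁] [NormedAddCommGroup Y₁]
  [NormedSpace ℂ Y₁]

theorem Represents.flip {P : X →L[ℂ] Y →L[ℂ] ℂ} (hP : Represents P) : Represents P.flip :=
  ⟨hP.right, hP.left⟩

/-- One half of the closed range theorem, for a closed linear relation `Γ` and its adjoint `Γ'`
(up to the nonzero factor `c`). -/
theorem isClosed_range_adjoint [CompleteSpace X] [CompleteSpace X₁] {P : X →L[ℂ] Y →L[ℂ] ℂ}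
    {P₁ : X₁ →L[ℂ] Y₁ →L[ℂ] ℂ} (hP₁ : Represents P₁) {c : ℂ}
    (Γ : Submodule ℂ (X × X₁)) (Γ' : Submodule ℂ (Y₁ × Y)) (hΓ : IsClosed (Γ : Set (X × X₁)))
    (hadj : ∀ g h, (g, h) ∈ Γ' ↔ ∀ x y, (x, y) ∈ Γ → P₁ y g = c * P x h) (hc : c ≠ 0)
    (hR : IsClosed (Γ.map (LinearMap.snd ℂ X X₁) : Set X₁)) :
    IsClosed (Γ'.map (LinearMap.snd ℂ Y₁ Y) : Set Y) := by
  -- The range of the adjoint is the full annihilator of the kernel of `Γ`; an annihilator is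
  -- visibly closed.
  have hEq : (Γ'.map (LinearMap.snd ℂ Y₁ Y) : Set Y) =
      ⋂ x ∈ {x : X | (x, (0 : X₁)) ∈ Γ}, {h | P x h = 0} := by
    ext h
    simp only [Submodule.map_coe, LinearMap.snd_apply, Set.mem_image, SetLike.mem_coe, Prod.exists,
      exists_eq_right, Set.mem_ofPred_eq, Set.mem_iInter]
    constructor
    · rintro ⟨g, hg⟩ x hx
      have := (hadj g h).mp hg x 0 hx
      simpa [hc] using this
    intro hh
    set R : Submodule ℂ X₁ := Γ.map (LinearMap.snd ℂ X X₁) with hRdef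
    have : CompleteSpace R := hR.completeSpace_coe
    have : CompleteSpace Γ := hΓ.completeSpace_coe
    let π : Γ →L[ℂ] R := ((ContinuousLinearMap.snd ℂ X X₁).comp Γ.subtypeL).codRestrict R
      fun z => ⟨z, z.2, rfl⟩
    have hπ : Function.Surjective π := by
      rintro ⟨y, z, hz, rfl⟩
      exact ⟨⟨z, hz⟩, rfl⟩
    -- Open mapping theorem: `Γ` and its closed range are both Banach, so preimages can be chosen
    -- with norm at most `C` times that of the image.
    obtain ⟨C, hC, hpre⟩ := π.exists_preimage_norm_le hπ
    -- Since `h` annihilates the kernel, the value `P x h` depends only on the second entry of `(x,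
    -- y) ∈ Γ`.
    have hwd : ∀ z z' : Γ, π z = π z' → P z.1.1 h = P z'.1.1 h := by
      intro z z' hzz
      have h1 : z.1.2 = z'.1.2 := congrArg Subtype.val hzz
      have h2 : (z.1.1 - z'.1.1, (0 : X₁)) ∈ Γ := by
        have := Γ.sub_mem z.2 z'.2
        rwa [show z.1 - z'.1 = (z.1.1 - z'.1.1, (0 : X₁)) from
          Prod.ext rfl (by simp [h1])] at this
      have h3 := hh _ h2
      rwa [map_sub, sub_apply, sub_eq_zero] at h3
    choose σ hσ hσn using hpre
    let ℓ : R →ₗ[ℂ] ℂ :=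
      { toFun := fun y => c * P (σ y).1.1 h
        map_add' := fun y y' => by
          rw [hwd (σ (y + y')) (σ y + σ y') (by rw [map_add, hσ, hσ, hσ])]
          simp [mul_add]
        map_smul' := fun a y => by
          rw [hwd (σ (a • y)) (a • σ y) (by rw [map_smul, hσ, hσ])]
          simp [mul_left_comm] }
    let ℓc : R →L[ℂ] ℂ := ℓ.mkContinuous (‖c‖ * (‖P.flip h‖ * C)) fun y => by
      change ‖c * P.flip h (σ y).1.1‖ ≤ _
      rw [norm_mul, mul_assoc]
      gcongr
      refine ((P.flip h).le_opNorm _).trans ?_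
      rw [mul_assoc]
      gcongr
      exact (norm_fst_le (σ y).1).trans (hσn y)
    -- The functional `y ↦ c * P x h` on the range extends by Hahn–Banach, and the element `g`
    -- representing the extension satisfies the adjoint relation with `h`.
    obtain ⟨ψ, hψ, -⟩ := exists_extension_norm_eq R ℓc
    obtain ⟨g, hg⟩ := hP₁.left ψ
    refine ⟨g, (hadj g h).mpr fun x y hxy => ?_⟩
    let y' : R := ⟨y, (x, y), hxy, rfl⟩
    rw [← hg, show y = (y' : X₁) from rfl, hψ]
    change c * P (σ y').1.1 h = _
    rw [hwd (σ y') ⟨(x, y), hxy⟩ (by rw [hσ]; rfl)]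
  rw [hEq]
  exact isClosed_biInter fun x _ => isClosed_eq (P x).continuous continuous_const

/-- **Closed range theorem** for a pair of mutually adjoint linear relations. -/
theorem isClosed_range_iff [CompleteSpace X] [CompleteSpace X₁] [CompleteSpace Y] [CompleteSpace Y₁]
    {P : X →L[ℂ] Y →L[ℂ] ℂ} {P₁ : X₁ →L[ℂ] Y₁ →L[ℂ] ℂ} (hP : Represents P) (hP₁ : Represents P₁)
    {c : ℂ} (hc : c ≠ 0) (Γ : Submodule ℂ (X × X₁)) (Γ' : Submodule ℂ (Y₁ × Y))
    (hadj : ∀ g h, (g, h) ∈ Γ' ↔ ∀ x y, (x, y) ∈ Γ → P₁ y g = c * P x h)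
    (hadj' : ∀ x y, (x, y) ∈ Γ ↔ ∀ g h, (g, h) ∈ Γ' → P₁ y g = c * P x h) :
    IsClosed (Γ.map (LinearMap.snd ℂ X X₁) : Set X₁) ↔
      IsClosed (Γ'.map (LinearMap.snd ℂ Y₁ Y) : Set Y) := by
  have hcl : IsClosed (Γ : Set (X × X₁)) := by
    have : (Γ : Set (X × X₁)) = ⋂ z ∈ (Γ' : Set (Y₁ × Y)), {w | P₁ w.2 z.1 = c * P w.1 z.2} := by
      ext ⟨x, y⟩
      simp only [SetLike.mem_coe, hadj', Set.mem_iInter, Prod.forall, Set.mem_ofPred_eq]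
    rw [this]
    refine isClosed_biInter fun z _ => isClosed_eq ?_ ?_
    · exact (P₁.flip z.1).continuous.comp continuous_snd
    · exact continuous_const.mul ((P.flip z.2).continuous.comp continuous_fst)
  have hcl' : IsClosed (Γ' : Set (Y₁ × Y)) := by
    have : (Γ' : Set (Y₁ × Y)) = ⋂ z ∈ (Γ : Set (X × X₁)), {w | P₁ z.2 w.1 = c * P z.1 w.2} := by
      ext ⟨x, y⟩
      simp only [SetLike.mem_coe, hadj, Set.mem_iInter, Prod.forall, Set.mem_ofPred_eq]
    rw [this]
    refine isClosed_biInter fun z _ => isClosed_eq ?_ ?_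
    · exact (P₁ z.2).continuous.comp continuous_fst
    · exact continuous_const.mul ((P z.1).continuous.comp continuous_snd)
  refine ⟨isClosed_range_adjoint hP₁ Γ Γ' hcl hadj hc, ?_⟩
  -- The converse is the same half with the two relations exchanged, which inverts the factor `c`.
  refine isClosed_range_adjoint (P := P₁.flip) (P₁ := P.flip) (c := c⁻¹) hP.flip Γ' Γ hcl'
    (fun x y => ?_) (inv_ne_zero hc)
  rw [hadj']
  refine forall₃_congr fun g h _ => ?_
  simp only [ContinuousLinearMap.flip_apply]
  rw [eq_inv_mul_iff_mul_eq₀ hc, eq_comm]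

/-- Stated for any linear topological quotient map, so that it serves both restriction to `D` and
the passage to reduced cohomology. -/
theorem exists_lift_of_isQuotientMap {E H G : Type*} [SeminormedAddCommGroup E] [NormedSpace ℂ E]
    [SeminormedAddCommGroup H] [NormedSpace ℂ H] [SeminormedAddCommGroup G] [NormedSpace ℂ G]
    (π : E →ₗ[ℂ] H) (hπ : Topology.IsQuotientMap π) (f : E →L[ℂ] G) (hf : ∀ x, π x = 0 → f x = 0) :
    ∃ g : H →L[ℂ] G, ∀ x, g (π x) = f x := by
  choose σ hσ using hπ.surjective
  have hwd : ∀ x x', π x = π x' → f x = f x' := fun x x' h => by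
    rw [← sub_eq_zero, ← map_sub]
    exact hf _ (by rw [map_sub, h, sub_self])
  have hg : ∀ x, f (σ (π x)) = f x := fun x => hwd _ _ (hσ _)
  refine ⟨⟨⟨⟨fun y => f (σ y), fun y y' => ?_⟩, fun c y => ?_⟩, ?_⟩, hg⟩
  · rw [← map_add]
    exact hwd _ _ (by rw [map_add, hσ, hσ, hσ])
  · rw [RingHom.id_apply, ← map_smul]
    exact hwd _ _ (by rw [map_smul, hσ, hσ])
  · rw [hπ.continuous_iff]
    exact f.continuous.congr fun x => (hg x).symm

end

end SobolevDolbeault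
end

/-! ### Hausdorff quotients and perfect pairings -/

noncomputable section
namespace SobolevDolbeault

section

variable {X : Type*} [NormedAddCommGroup X] [NormedSpace ℂ X]

theorem t2Space_quotient_iff {B Z : Submodule ℂ X} (hBZ : B ≤ Z) (hZ : IsClosed (Z : Set X)) :
    T2Space (Z ⧸ B.submoduleOf Z) ↔ IsClosed (B : Set X) := by
  have h1 : IsClosed (B.submoduleOf Z : Set Z) ↔ IsClosed (B : Set X) := by
    rw [hZ.isClosedEmbedding_subtypeVal.isClosed_iff_image_isClosed]
    have : (Subtype.val '' (B.submoduleOf Z : Set Z) : Set X) = B := by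
      ext x
      simp only [Set.mem_image, SetLike.mem_coe]
      exact ⟨by rintro ⟨y, hy, rfl⟩; exact hy, fun hx => ⟨⟨x, hBZ hx⟩, hx, rfl⟩⟩
    rw [← this]
    rfl
  rw [← h1]
  constructor
  · intro h
    have : (B.submoduleOf Z : Set Z) = (B.submoduleOf Z).mkQ ⁻¹' {0} := by
      ext z
      simp [Submodule.Quotient.mk_eq_zero]
    rw [this]
    exact isClosed_singleton.preimage (B.submoduleOf Z).mkQL.continuous
  · intro h
    have := h
    infer_instance

/-- The Hausdorff quotient of `Z / B`. -/
def RedQuotient (B Z : Submodule ℂ X) : Type _ := SeparationQuotient (Z ⧸ B.submoduleOf Z)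

instance (B Z : Submodule ℂ X) : NormedAddCommGroup (RedQuotient B Z) :=
  inferInstanceAs (NormedAddCommGroup (SeparationQuotient (Z ⧸ B.submoduleOf Z)))

instance (B Z : Submodule ℂ X) : NormedSpace ℂ (RedQuotient B Z) :=
  inferInstanceAs (NormedSpace ℂ (SeparationQuotient (Z ⧸ B.submoduleOf Z)))

/-- The map of `Z` onto the Hausdorff quotient of `Z / B`. -/
def redMk (B Z : Submodule ℂ X) : Z →ₗ[ℂ] RedQuotient B Z :=
  (SeparationQuotient.mkCLM ℂ (Z ⧸ B.submoduleOf Z)).toLinearMap ∘ₗ (B.submoduleOf Z).mkQ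

theorem redMk_isQuotientMap (B Z : Submodule ℂ X) : Topology.IsQuotientMap (redMk B Z) :=
  SeparationQuotient.isQuotientMap_mk.comp (B.submoduleOf Z).isOpenQuotientMap_mkQ.isQuotientMap

theorem redMk_eq_zero_iff {B Z : Submodule ℂ X} (hBZ : B ≤ Z) (z : Z) :
    redMk B Z z = 0 ↔ (z : X) ∈ B.topologicalClosure := by
  have h1 : redMk B Z z = 0 ↔ z ∈ closure (B.submoduleOf Z : Set Z) := by
    rw [← norm_eq_zero]
    change ‖(B.submoduleOf Z).mkQ z‖ = 0 ↔ _
    exact QuotientAddGroup.norm_mk_eq_zero_iff_mem_closure (S := (B.submoduleOf Z).toAddSubgroup)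
  rw [h1, closure_subtype]
  have : (Subtype.val '' (B.submoduleOf Z : Set Z) : Set X) = B := by
    ext x
    simp only [Set.mem_image, SetLike.mem_coe]
    exact ⟨by rintro ⟨y, hy, rfl⟩; exact hy, fun hx => ⟨⟨x, hBZ hx⟩, hx, rfl⟩⟩
  rw [this]
  rfl

theorem completeSpace_red [CompleteSpace X] (B : Submodule ℂ X) {Z : Submodule ℂ X}
    (hZ : IsClosed (Z : Set X)) :
    CompleteSpace (RedQuotient B Z) := by
  have : CompleteSpace Z := hZ.completeSpace_coe
  have : CompleteSpace (Z ⧸ B.submoduleOf Z) := inferInstance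
  exact inferInstanceAs (CompleteSpace (SeparationQuotient (Z ⧸ B.submoduleOf Z)))

end

section

variable {X Y : Type} [NormedAddCommGroup X] [NormedSpace ℂ X] [NormedAddCommGroup Y]
  [NormedSpace ℂ Y]

/-- Existence: pull `φ` back to `Z`, extend to `X` and represent by some `y`; as `φ` kills classes
of `B`, `y` annihilates `B` and so lies in `Z'`. Uniqueness: the difference of two representatives
annihilates `Z`, and Hahn–Banach forces it into the closure of `B'`. -/
theorem exists_unique_redMk_represents {P : X →L[ℂ] Y →L[ℂ] ℂ} (hP : Represents P)
    {B Z : Submodule ℂ X} {B' Z' : Submodule ℂ Y} (hBZ : B ≤ Z) (hBZ' : B' ≤ Z')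
    (hZ : ∀ x, x ∈ Z ↔ ∀ y ∈ B', P x y = 0) (hZ' : ∀ y, y ∈ Z' ↔ ∀ x ∈ B, P x y = 0)
    (β : RedQuotient B Z →L[ℂ]
      RedQuotient B' Z' →L[ℂ] ℂ)
    (hβ : ∀ f g, β (redMk B Z f) (redMk B' Z' g) = P f g)
    (φ : RedQuotient B Z →L[ℂ] ℂ) :
    ∃! y, ∀ x, φ x = β x y := by
  let π : Z →L[ℂ] RedQuotient B Z :=
    ⟨redMk B Z, (redMk_isQuotientMap B Z).continuous⟩
  obtain ⟨Φ, hΦ, -⟩ := exists_extension_norm_eq Z (φ.comp π)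
  obtain ⟨y, hy⟩ := hP.left Φ
  have hyZ : y ∈ Z' := (hZ' y).mpr fun x hx => by
    rw [← hy, hΦ ⟨x, hBZ hx⟩]
    have : redMk B Z ⟨x, hBZ hx⟩ = 0 :=
      (redMk_eq_zero_iff hBZ _).mpr (B.le_topologicalClosure hx)
    change φ (redMk B Z ⟨x, hBZ hx⟩) = 0
    rw [this, map_zero]
  refine ⟨redMk B' Z' ⟨y, hyZ⟩, fun x => ?_, fun y' hy' => ?_⟩
  · obtain ⟨x, rfl⟩ := (redMk_isQuotientMap B Z).surjective x
    rw [hβ, ← hy, hΦ]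
    rfl
  · obtain ⟨w, rfl⟩ := (redMk_isQuotientMap B' Z').surjective y'
    rw [← sub_eq_zero, ← map_sub, redMk_eq_zero_iff hBZ']
    -- A functional that kills `B'` but not `w - y` is represented by an element of `Z`, because `Z`
    -- is the annihilator of `B'`; yet `w - y` annihilates `Z`.
    by_contra hw
    obtain ⟨ψ, hψ, hψw⟩ := exists_functional_of_notMem_closure B' hw
    obtain ⟨x, hx⟩ := hP.right ψ
    have hxZ : x ∈ Z := (hZ x).mpr fun b hb => by rw [← hx, hψ b hb]
    apply hψw
    rw [hx]
    have h1 := hy' (redMk B Z ⟨x, hxZ⟩)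
    rw [hβ] at h1
    have h2 : φ (redMk B Z ⟨x, hxZ⟩) = P x y := by
      rw [← hy, hΦ ⟨x, hxZ⟩]
      rfl
    change P x (w - y) = 0
    rw [map_sub, ← h1, h2, sub_self]

/-- The pairing descends because `Z` kills `B'` and `Z'` kills `B`, hence by continuity their
closures. The hypotheses are symmetric, so the second half of perfectness is the first for the
flipped pairing. -/
theorem exists_perfect_pairing {P : X →L[ℂ] Y →L[ℂ] ℂ} (hP : Represents P)
    {B Z : Submodule ℂ X} {B' Z' : Submodule ℂ Y} (hBZ : B ≤ Z) (hBZ' : B' ≤ Z')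
    (hZ : ∀ x, x ∈ Z ↔ ∀ y ∈ B', P x y = 0) (hZ' : ∀ y, y ∈ Z' ↔ ∀ x ∈ B, P x y = 0) :
    ∃ β : RedQuotient B Z →L[ℂ]
      RedQuotient B' Z' →L[ℂ] ℂ,
      (∀ f g, β (redMk B Z f) (redMk B' Z' g) = P f g) ∧ IsPerfect _ _ β := by
  let Q : Z' →L[ℂ] Z →L[ℂ] ℂ := P.flip.bilinearComp Z'.subtypeL Z.subtypeL
  have hQ : ∀ g f, Q g f = P f g := fun _ _ => rfl
  obtain ⟨R, hR⟩ := exists_lift_of_isQuotientMap (G := Z →L[ℂ] ℂ) (redMk B' Z')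
    (redMk_isQuotientMap B' Z') Q
    fun g hg => by
      ext f
      rw [redMk_eq_zero_iff hBZ'] at hg
      have hcl : IsClosed {y | P f y = 0} := isClosed_eq (P f).continuous continuous_const
      exact closure_minimal (fun y hy => (hZ f).mp f.2 y hy) hcl hg
  obtain ⟨β, hβ⟩ := exists_lift_of_isQuotientMap (G := RedQuotient B' Z' →L[ℂ] ℂ) (redMk B Z)
    (redMk_isQuotientMap B Z) R.flip
    fun f hf => by
      ext g
      obtain ⟨g, rfl⟩ := (redMk_isQuotientMap B' Z').surjective g
      rw [redMk_eq_zero_iff hBZ] at hf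
      have hcl : IsClosed {x | P x g = 0} := isClosed_eq (P.flip g).continuous continuous_const
      rw [ContinuousLinearMap.flip_apply, hR]
      exact closure_minimal (fun x hx => (hZ' g).mp g.2 x hx) hcl hf
  have hβ' : ∀ f g, β (redMk B Z f) (redMk B' Z' g) = P f g := fun f g => by
    rw [hβ, ContinuousLinearMap.flip_apply, hR, hQ]
  refine ⟨β, hβ', exists_unique_redMk_represents hP hBZ hBZ' hZ hZ' β hβ', fun ψ => ?_⟩
  exact exists_unique_redMk_represents hP.flip hBZ' hBZ hZ' hZ β.flip (fun g f => hβ' f g) ψ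

end

end SobolevDolbeault
end

/-! ### Duality of `W^s(ℂⁿ)` and `W^{-s}(ℂⁿ)` -/

noncomputable section
namespace SobolevDolbeault

open FourierTransform

/-- The symbol `(1 + |ξ|²)^{s/2}` of the Bessel potential. -/
def besselSymbol (n : ℕ) (s : ℝ) (ξ : Cn n) : ℂ := (((1 + ‖ξ‖ ^ 2) ^ (s / 2) : ℝ) : ℂ)

@[fun_prop]
theorem besselSymbol_hasTemperateGrowth (n : ℕ) (s : ℝ) : (besselSymbol n s).HasTemperateGrowth := by
  unfold besselSymbol
  fun_prop

theorem besselSymbol_mul (n : ℕ) (s t : ℝ) :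
    besselSymbol n s * besselSymbol n t = besselSymbol n (s + t) := by
  ext ξ
  simp only [besselSymbol, Pi.mul_apply]
  rw [← Complex.ofReal_mul, ← Real.rpow_add (by positivity)]
  ring_nf

theorem besselSymbol_zero (n : ℕ) : besselSymbol n 0 = fun _ => 1 := by
  ext ξ; simp [besselSymbol]

theorem besselSymbol_neg_arg (n : ℕ) (s : ℝ) (ξ : Cn n) :
    besselSymbol n s (-ξ) = besselSymbol n s ξ := by
  simp [besselSymbol]

theorem besselSymbol_smul_smul {n : ℕ} (s : ℝ) (u : 𝓢'(Cn n, ℂ)) :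
    smulLeftCLM ℂ (besselSymbol n (-s)) (smulLeftCLM ℂ (besselSymbol n s) u) = u := by
  rw [smulLeftCLM_smulLeftCLM_apply (by fun_prop) (by fun_prop), besselSymbol_mul]
  simp [besselSymbol_zero]

/-- The multiplier operator with an even symbol is the same whether built from `𝓕` or `𝓕⁻`. -/
theorem fourierInv_besselPotential {n : ℕ} (s : ℝ) (u : 𝓢'(Cn n, ℂ)) :
    𝓕⁻ (besselPotential (Cn n) ℂ s u) = smulLeftCLM ℂ (besselSymbol n s) (𝓕⁻ u) := by
  -- With everything moved onto the test function, the two transforms differ by a reflection, which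
  -- the even symbol does not see.
  have key : ∀ φ : 𝓢(Cn n, ℂ),
      𝓕 (SchwartzMap.smulLeftCLM ℂ (besselSymbol n s) (𝓕⁻ (𝓕⁻ φ))) =
        𝓕⁻ (SchwartzMap.smulLeftCLM ℂ (besselSymbol n s) φ) := by
    intro φ
    ext x
    have e1 : ∀ g : 𝓢(Cn n, ℂ), (𝓕 g) x = (𝓕⁻ g) (-x) := by
      intro g
      rw [SchwartzMap.fourierInv_coe, SchwartzMap.fourier_coe, Real.fourierInv_eq_fourier_neg, neg_neg]
    rw [e1]
    have e2 : ∀ y, (𝓕⁻ (𝓕⁻ φ)) y = φ (-y) := by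
      intro y
      have h2 : 𝓕 (𝓕⁻ φ) = φ := fourier_fourierInv_eq φ
      rw [← SchwartzMap.ext_iff.mp h2 (-y)]
      rw [SchwartzMap.fourierInv_coe, SchwartzMap.fourier_coe, Real.fourierInv_eq_fourier_neg]
    rw [SchwartzMap.fourierInv_coe, SchwartzMap.fourierInv_coe]
    rw [Real.fourierInv_eq_fourier_neg, neg_neg, Real.fourierInv_eq_fourier_comp_neg]
    refine congrArg (fun g : Cn n → ℂ => 𝓕 g x) (funext fun y => ?_)
    rw [SchwartzMap.smulLeftCLM_apply_apply (by fun_prop), SchwartzMap.smulLeftCLM_apply_apply (by fun_prop),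
      e2, besselSymbol_neg_arg]
  ext φ
  change u (𝓕 (SchwartzMap.smulLeftCLM ℂ (besselSymbol n s) (𝓕⁻ (𝓕⁻ φ)))) =
    u (𝓕⁻ (SchwartzMap.smulLeftCLM ℂ (besselSymbol n s) φ))
  rw [key]

namespace Sobolev

variable {n : ℕ} {s : ℝ}

/-- The `L²` function `(1 + |ξ|²)^{s/2} û`. -/
def freq (s : ℝ) : Sobolev n s →ₗᵢ[ℂ] Lp ℂ 2 (volume : Measure (Cn n)) :=
  (Lp.fourierTransformₗᵢ (Cn n) ℂ).toLinearIsometry.comp ⟨toL2, fun _ => rfl⟩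

/-- The `L²` function `(1 + |ξ|²)^{s/2} û(-ξ)`. -/
def freqInv (s : ℝ) : Sobolev n s →ₗᵢ[ℂ] Lp ℂ 2 (volume : Measure (Cn n)) :=
  (Lp.fourierTransformₗᵢ (Cn n) ℂ).symm.toLinearIsometry.comp ⟨toL2, fun _ => rfl⟩

theorem toL2_surjective :
    Function.Surjective (toL2 : Sobolev n s →ₗ[ℂ] Lp ℂ 2 (volume : Measure (Cn n))) := by
  intro f
  have h : besselPotential (Cn n) ℂ s (besselPotential (Cn n) ℂ (-s) (f : 𝓢'(Cn n, ℂ))) = f := by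
    simp
  let u : Sobolev n s := ⟨_, f, h⟩
  exact ⟨u, lp_dist_injective ((besselPotential_dist u).symm.trans h)⟩

theorem freq_surjective : Function.Surjective (freq (n := n) s) :=
  (Lp.fourierTransformₗᵢ (Cn n) ℂ).surjective.comp toL2_surjective

theorem freqInv_surjective : Function.Surjective (freqInv (n := n) s) :=
  (Lp.fourierTransformₗᵢ (Cn n) ℂ).symm.surjective.comp toL2_surjective

theorem smul_fourier_dist (u : Sobolev n s) :
    smulLeftCLM ℂ (besselSymbol n s) (𝓕 u.dist) = (freq s u : 𝓢'(Cn n, ℂ)) := by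
  have h := congrArg 𝓕 u.besselPotential_dist
  rw [fourier_besselPotential_eq_smulLeftCLM_fourier_apply, Lp.fourier_toTemperedDistribution_eq] at h
  exact h

theorem smul_fourierInv_dist (u : Sobolev n s) :
    smulLeftCLM ℂ (besselSymbol n s) (𝓕⁻ u.dist) = (freqInv s u : 𝓢'(Cn n, ℂ)) := by
  have h := congrArg 𝓕⁻ u.besselPotential_dist
  rw [fourierInv_besselPotential, Lp.fourierInv_toTemperedDistribution_eq] at h
  exact h

theorem dist_injective : Function.Injective (dist : Sobolev n s →ₗ[ℂ] 𝓢'(Cn n, ℂ)) :=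
  Subtype.val_injective

theorem freq_ofSchwartz (φ : 𝓢(Cn n, ℂ)) :
    freq s (ofSchwartz s φ) = (SchwartzMap.smulLeftCLM ℂ (besselSymbol n s) (𝓕 φ)).toLp 2 := by
  apply lp_dist_injective
  rw [← smul_fourier_dist, Lp.toTemperedDistribution_toLp_eq]
  change smulLeftCLM ℂ (besselSymbol n s) (𝓕 (SchwartzMap.toTemperedDistributionCLM (Cn n) ℂ volume φ)) = _
  rw [fourier_toTemperedDistributionCLM_eq]
  ext ψ
  simp only [smulLeftCLM_apply_apply, SchwartzMap.toTemperedDistributionCLM_apply_apply]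
  refine integral_congr_ae (Filter.Eventually.of_forall fun x => ?_)
  simp only [SchwartzMap.smulLeftCLM_apply_apply (besselSymbol_hasTemperateGrowth n s), smul_eq_mul]
  ring

theorem freqInv_ofSchwartz (φ : 𝓢(Cn n, ℂ)) :
    freqInv s (ofSchwartz s φ) = (SchwartzMap.smulLeftCLM ℂ (besselSymbol n s) (𝓕⁻ φ)).toLp 2 := by
  apply lp_dist_injective
  rw [← smul_fourierInv_dist, Lp.toTemperedDistribution_toLp_eq]
  change smulLeftCLM ℂ (besselSymbol n s) (𝓕⁻ (SchwartzMap.toTemperedDistributionCLM (Cn n) ℂ volume φ)) = _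
  rw [fourierInv_toTemperedDistributionCLM_eq]
  ext ψ
  simp only [smulLeftCLM_apply_apply, SchwartzMap.toTemperedDistributionCLM_apply_apply]
  refine integral_congr_ae (Filter.Eventually.of_forall fun x => ?_)
  simp only [SchwartzMap.smulLeftCLM_apply_apply (besselSymbol_hasTemperateGrowth n s), smul_eq_mul]
  ring

/-- The bilinear form `∫ f g` on `L²`. -/
def l2Pairing (n : ℕ) : Lp ℂ 2 (volume : Measure (Cn n)) →L[ℂ]
    Lp ℂ 2 (volume : Measure (Cn n)) →L[ℂ] ℂ :=
  (ContinuousLinearMap.mul ℂ ℂ).lpPairing volume 2 2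

theorem l2Pairing_apply (f g : Lp ℂ 2 (volume : Measure (Cn n))) :
    l2Pairing n f g = ∫ x, f x * g x := by
  simp [l2Pairing, ContinuousLinearMap.lpPairing_eq_integral]

theorem l2Pairing_flip : (l2Pairing n).flip = l2Pairing n := by
  ext f g
  simp only [ContinuousLinearMap.flip_apply, l2Pairing_apply, mul_comm]

theorem l2Pairing_toLp (f : Lp ℂ 2 (volume : Measure (Cn n))) (φ : 𝓢(Cn n, ℂ)) :
    l2Pairing n f (φ.toLp 2) = (f : 𝓢'(Cn n, ℂ)) φ := by
  rw [l2Pairing_apply, Lp.toTemperedDistribution_apply]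
  refine integral_congr_ae ?_
  filter_upwards [φ.coeFn_toLp 2 volume] with x hx
  rw [hx, smul_eq_mul, mul_comm]

/-- Riesz representation; the pairing is bilinear, so the Riesz vector is conjugated. -/
theorem l2Pairing_represents (ψ : Lp ℂ 2 (volume : Measure (Cn n)) →L[ℂ] ℂ) :
    ∃ f, ∀ g, ψ g = l2Pairing n f g := by
  refine ⟨star ((InnerProductSpace.toDual ℂ _).symm ψ), fun g => ?_⟩
  have h : ψ g = inner ℂ ((InnerProductSpace.toDual ℂ _).symm ψ) g := by
    rw [InnerProductSpace.toDual_symm_apply]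
  rw [h, l2Pairing_apply, L2.inner_def]
  refine integral_congr_ae ?_
  filter_upwards [Lp.coeFn_star ((InnerProductSpace.toDual ℂ _).symm ψ)] with x hx
  rw [hx]
  simp [mul_comm]

/-- The duality pairing of `W^s` and `W^{-s}` extending `∫ f g`. -/
def pairing (n : ℕ) (s : ℝ) : Sobolev n s →L[ℂ] Sobolev n (-s) →L[ℂ] ℂ :=
  (l2Pairing n).bilinearComp (freq s).toContinuousLinearMap (freqInv (-s)).toContinuousLinearMap

theorem pairing_eq (u : Sobolev n s) (v : Sobolev n (-s)) :
    pairing n s u v = l2Pairing n (freq s u) (freqInv (-s) v) := rfl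

theorem pairing_apply (u : Sobolev n s) (v : Sobolev n (-s)) :
    pairing n s u v = ∫ ξ, freq s u ξ * freqInv (-s) v ξ := by
  rw [pairing_eq, l2Pairing_apply]

/-- The weights of orders `s` and `-s` cancel, leaving `û` evaluated at the inverse transform of
`φ`, which is `u(φ)`. This is why the second factor enters through `freqInv` rather than `freq`. -/
theorem pairing_ofSchwartz_right (u : Sobolev n s) (φ : 𝓢(Cn n, ℂ)) :
    pairing n s u (ofSchwartz (-s) φ) = u.dist φ := by
  rw [pairing_eq, freqInv_ofSchwartz, l2Pairing_toLp, ← smul_fourier_dist, ← smulLeftCLM_apply_apply,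
    besselSymbol_smul_smul, TemperedDistribution.fourier_apply, fourier_fourierInv_eq]

theorem pairing_ofSchwartz_left (φ : 𝓢(Cn n, ℂ)) (v : Sobolev n (-s)) :
    pairing n s (ofSchwartz s φ) v = v.dist φ := by
  rw [pairing_eq, freq_ofSchwartz, ← l2Pairing_flip, ContinuousLinearMap.flip_apply, l2Pairing_toLp,
    ← smul_fourierInv_dist, ← smulLeftCLM_apply_apply]
  have h := besselSymbol_smul_smul (-s) (𝓕⁻ v.dist)
  rw [neg_neg] at h
  rw [h, TemperedDistribution.fourierInv_apply, fourierInv_fourier_eq]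

theorem pairing_represents_right (ψ : Sobolev n (-s) →L[ℂ] ℂ) :
    ∃ u, ∀ v, ψ v = pairing n s u v := by
  let e := LinearIsometryEquiv.ofSurjective (freqInv (n := n) (-s)) freqInv_surjective
  obtain ⟨f, hf⟩ := l2Pairing_represents (ψ.comp e.symm.toLinearIsometry.toContinuousLinearMap)
  obtain ⟨u, rfl⟩ := freq_surjective (s := s) f
  refine ⟨u, fun v => ?_⟩
  have := hf (e v)
  simp only [ContinuousLinearMap.comp_apply] at this
  rw [pairing_eq, ← show e v = freqInv (-s) v from rfl, ← this]
  congr 1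
  exact (e.symm_apply_apply v).symm

theorem pairing_represents_left (ψ : Sobolev n s →L[ℂ] ℂ) :
    ∃ v, ∀ u, ψ u = pairing n s u v := by
  let e := LinearIsometryEquiv.ofSurjective (freq (n := n) s) freq_surjective
  obtain ⟨f, hf⟩ := l2Pairing_represents (ψ.comp e.symm.toLinearIsometry.toContinuousLinearMap)
  obtain ⟨v, rfl⟩ := freqInv_surjective (s := -s) f
  refine ⟨v, fun u => ?_⟩
  have := hf (e u)
  simp only [ContinuousLinearMap.comp_apply] at this
  rw [pairing_eq, ← l2Pairing_flip, ContinuousLinearMap.flip_apply,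
    ← show e u = freq s u from rfl, ← this]
  congr 1
  exact (e.symm_apply_apply u).symm

instance : CompleteSpace (Sobolev n s) :=
  ((LinearIsometryEquiv.ofSurjective (freq (n := n) s) freq_surjective).toIsometryEquiv).completeSpace

/-- `ofSchwartz` as a linear map. -/
def ofSchwartzₗ (n : ℕ) (s : ℝ) : 𝓢(Cn n, ℂ) →ₗ[ℂ] Sobolev n s where
  toFun := ofSchwartz s
  map_add' f g := dist_injective (map_add (SchwartzMap.toTemperedDistributionCLM (Cn n) ℂ volume) f g)
  map_smul' c f :=
    dist_injective (map_smul (SchwartzMap.toTemperedDistributionCLM (Cn n) ℂ volume) c f)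

@[simp] theorem ofSchwartzₗ_apply (φ : 𝓢(Cn n, ℂ)) : ofSchwartzₗ n s φ = ofSchwartz s φ := rfl

theorem dist_ofSchwartz (φ ψ : 𝓢(Cn n, ℂ)) : (ofSchwartz s φ).dist ψ = ∫ x, ψ x * φ x :=
  SchwartzMap.toTemperedDistributionCLM_apply_apply volume φ ψ

/-- A functional that vanishes on Schwartz functions is the pairing with some `v` which is zero as a
distribution. -/
theorem denseRange_ofSchwartz : DenseRange (ofSchwartzₗ n s) := by
  have h : (LinearMap.range (ofSchwartzₗ n s)).topologicalClosure = ⊤ := by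
    refine eq_top_iff.mpr fun x _ => ?_
    by_contra hx
    obtain ⟨f, hf, hfx⟩ := exists_functional_of_notMem_closure _ hx
    obtain ⟨v, hv⟩ := pairing_represents_left f
    apply hfx
    have : v = 0 := by
      apply dist_injective
      ext φ
      rw [← pairing_ofSchwartz_left (s := s), ← hv]
      exact hf (ofSchwartz s φ) ⟨φ, rfl⟩
    rw [hv, this, map_zero]
  have := (Submodule.dense_iff_topologicalClosure_eq_top).mpr h
  exact this

end Sobolev

end SobolevDolbeault
end

/-! ### Multiplication by Schwartz functions on `W^s` -/

noncomputable section
namespace SobolevDolbeault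

open FourierTransform

/-- Peetre's inequality, from `|a + b|² ≤ 2|a|² + 2|b|²`. For `s ≥ 0` it is applied to `ξ = (ξ + η)
- η`, for `s ≤ 0` to `ξ + η` itself before inverting. -/
theorem peetre {n : ℕ} (s : ℝ) (ξ η : Cn n) :
    (1 + ‖ξ‖ ^ 2) ^ (s / 2) ≤
      (2 * (1 + ‖η‖ ^ 2)) ^ (|s| / 2) * (1 + ‖ξ + η‖ ^ 2) ^ (s / 2) := by
  have key : ∀ a b : Cn n, 1 + ‖a + b‖ ^ 2 ≤ 2 * (1 + ‖b‖ ^ 2) * (1 + ‖a‖ ^ 2) := fun a b => by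
    have h1 := norm_add_le a b
    have h2 := norm_nonneg (a + b)
    nlinarith [sq_nonneg (‖a‖ - ‖b‖), sq_nonneg (‖a‖ * ‖b‖), norm_nonneg a, norm_nonneg b]
  rcases le_total 0 s with hs | hs
  · rw [abs_of_nonneg hs, ← Real.mul_rpow (by positivity) (by positivity)]
    refine Real.rpow_le_rpow (by positivity) ?_ (by positivity)
    have := key (ξ + η) (-η)
    simpa using this
  · rw [abs_of_nonpos hs, ← mul_one ((1 + ‖ξ‖ ^ 2) ^ (s / 2))]
    have e : s / 2 = -(-s / 2) := by ring
    rw [e, Real.rpow_neg (by positivity), Real.rpow_neg (by positivity), ← div_eq_mul_inv,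
      mul_one, le_div_iff₀ (by positivity), inv_mul_le_iff₀ (by positivity), mul_comm,
      ← Real.mul_rpow (by positivity) (by positivity)]
    exact Real.rpow_le_rpow (by positivity) (key ξ η) (by linarith)

namespace Sobolev

variable {n : ℕ} {s : ℝ}

theorem norm_ofSchwartz (φ : 𝓢(Cn n, ℂ)) : ‖ofSchwartz s φ‖ =
    (eLpNorm (fun ξ => besselSymbol n s ξ * 𝓕 φ ξ) 2 volume).toReal := by
  rw [← (freq (n := n) s).norm_map, freq_ofSchwartz, SchwartzMap.norm_toLp]
  congr 2
  ext ξ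
  rw [SchwartzMap.smulLeftCLM_apply_apply (by fun_prop), smul_eq_mul]

/-- Modulation by the character of frequency `-η`. -/
def modulate (η : Cn n) (φ : 𝓢(Cn n, ℂ)) : 𝓢(Cn n, ℂ) :=
  𝓕⁻ (SchwartzMap.compSubConstCLM ℂ (-η) (𝓕 φ))

theorem fourier_modulate (η : Cn n) (φ : 𝓢(Cn n, ℂ)) (ξ : Cn n) :
    𝓕 (modulate η φ) ξ = 𝓕 φ (ξ + η) := by
  have h : 𝓕 (modulate η φ) = SchwartzMap.compSubConstCLM ℂ (-η) (𝓕 φ) := fourier_fourierInv_eq _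
  rw [h, SchwartzMap.compSubConstCLM_apply, sub_neg_eq_add]

theorem eLpNorm_le_of_norm_le_translate {G H : Cn n → ℂ} (hG : MemLp G 2 (volume : Measure (Cn n)))
    (η : Cn n) {C : ℝ} (hC : 0 ≤ C) (h : ∀ ξ, ‖H ξ‖ ≤ C * ‖G (ξ + η)‖) :
    (eLpNorm H 2 volume).toReal ≤ C * (eLpNorm G 2 volume).toReal := by
  have htr : eLpNorm (G ∘ fun ξ => ξ + η) 2 volume = eLpNorm G 2 volume :=
    eLpNorm_comp_measurePreserving hG.1 (measurePreserving_add_right volume η)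
  have hle : eLpNorm H 2 volume ≤ ENNReal.ofReal C * eLpNorm (G ∘ fun ξ => ξ + η) 2 volume :=
    eLpNorm_le_mul_eLpNorm_of_ae_le_mul (Filter.Eventually.of_forall h) 2
  rw [htr] at hle
  have := ENNReal.toReal_mono (ENNReal.mul_ne_top ENNReal.ofReal_ne_top hG.2.ne) hle
  rwa [ENNReal.toReal_mul, ENNReal.toReal_ofReal hC] at this

/-- Modulation translates the Fourier transform, so Peetre's inequality bounds its cost in `W^s` by
a power of `1 + |η|²`. -/
theorem norm_modulate_le (η : Cn n) (φ : 𝓢(Cn n, ℂ)) :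
    ‖ofSchwartz s (modulate η φ)‖ ≤ (2 * (1 + ‖η‖ ^ 2)) ^ (|s| / 2) * ‖ofSchwartz s φ‖ := by
  have hmem : MemLp (fun ξ => besselSymbol n s ξ * 𝓕 φ ξ) 2 (volume : Measure (Cn n)) := by
    refine MemLp.ae_eq (Filter.Eventually.of_forall fun ξ => ?_)
      ((SchwartzMap.smulLeftCLM ℂ (besselSymbol n s) (𝓕 φ)).memLp 2 volume)
    rw [SchwartzMap.smulLeftCLM_apply_apply (by fun_prop), smul_eq_mul]
  rw [norm_ofSchwartz, norm_ofSchwartz]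
  refine eLpNorm_le_of_norm_le_translate hmem η (by positivity) fun ξ => ?_
  rw [fourier_modulate, norm_mul, norm_mul, ← mul_assoc]
  refine mul_le_mul_of_nonneg_right ?_ (norm_nonneg _)
  simp only [besselSymbol, Complex.norm_real, Real.norm_eq_abs]
  have habs : ∀ ζ : Cn n, |(1 + ‖ζ‖ ^ 2) ^ (s / 2)| = (1 + ‖ζ‖ ^ 2) ^ (s / 2) := fun ζ =>
    abs_of_nonneg (by positivity)
  rw [habs, habs]
  exact peetre s ξ η

/-- `φ ↦ χ φ` for Schwartz functions. -/
abbrev smulS (χ φ : 𝓢(Cn n, ℂ)) : 𝓢(Cn n, ℂ) := SchwartzMap.smulLeftCLM ℂ χ φ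

theorem smulS_apply (χ φ : 𝓢(Cn n, ℂ)) (x : Cn n) : smulS χ φ x = χ x * φ x := by
  rw [smulS, SchwartzMap.smulLeftCLM_apply_apply χ.hasTemperateGrowth, smul_eq_mul]

theorem fourier_mul_eq (φ ψ : 𝓢(Cn n, ℂ)) (η : Cn n) :
    𝓕 (smulS φ ψ) η = ∫ x, ψ x * modulate η φ x := by
  have h1 : ∀ x, modulate η φ x = (Real.fourierChar (-inner ℝ x η) : ℂ) * φ x := fun x => by
    have h2 : 𝓕⁻ (𝓕 φ) = φ := fourierInv_fourier_eq φ
    conv_rhs => rw [← h2]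
    rw [modulate, SchwartzMap.fourierInv_coe, SchwartzMap.fourierInv_coe,
      Real.fourierInv_eq, Real.fourierInv_eq, ← integral_const_mul]
    rw [← integral_sub_right_eq_self _ η]
    refine integral_congr_ae (Filter.Eventually.of_forall fun ξ => ?_)
    simp only [SchwartzMap.compSubConstCLM_apply, Circle.smul_def, smul_eq_mul, sub_neg_eq_add,
      sub_add_cancel, inner_sub_left]
    rw [← mul_assoc, ← Circle.coe_mul, ← AddChar.map_add_eq_mul, real_inner_comm η x]
    congr 4
    ring
  rw [SchwartzMap.fourier_coe, Real.fourier_eq]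
  refine integral_congr_ae (Filter.Eventually.of_forall fun x => ?_)
  simp only [h1, smulS_apply, Circle.smul_def, smul_eq_mul]
  ring

theorem norm_fourier_mul_le (φ ψ : 𝓢(Cn n, ℂ)) (η : Cn n) :
    ‖𝓕 (smulS φ ψ) η‖ ≤
      (2 * (1 + ‖η‖ ^ 2)) ^ (|s| / 2) * ‖ofSchwartz s φ‖ * (‖pairing n s‖ * ‖ofSchwartz (-s) ψ‖) := by
  have h : 𝓕 (smulS φ ψ) η = pairing n s (ofSchwartz s (modulate η φ)) (ofSchwartz (-s) ψ) := by
    rw [pairing_ofSchwartz_right, dist_ofSchwartz, fourier_mul_eq]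
  rw [h]
  refine ((pairing n s).le_opNorm₂ _ _).trans ?_
  rw [mul_comm ‖pairing n s‖, mul_assoc]
  gcongr
  exact norm_modulate_le η φ

/-- Expanding `χ` in characters writes `∫ ψ χ φ` as a superposition of pairings of `ψ` with
modulations of `φ`. These grow polynomially in the frequency `η`, which the rapidly decreasing
inverse transform of `χ` absorbs. -/
theorem exists_norm_integral_le (s : ℝ) (χ : 𝓢(Cn n, ℂ)) : ∃ C, 0 ≤ C ∧ ∀ φ ψ : 𝓢(Cn n, ℂ),
    ‖∫ x, ψ x * smulS χ φ x‖ ≤ C * ‖ofSchwartz s φ‖ * ‖ofSchwartz (-s) ψ‖ := by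
  set χ' : 𝓢(Cn n, ℂ) := 𝓕⁻ χ
  have hχ : 𝓕 χ' = χ := fourier_fourierInv_eq χ
  set w : Cn n → ℝ := fun η => (2 * (1 + ‖η‖ ^ 2)) ^ (|s| / 2) with hw
  have hw0 : ∀ η, 0 ≤ w η := fun η => by positivity
  have hwint : Integrable (fun η => ‖χ' η‖ * w η) := by
    have := ((SchwartzMap.smulLeftCLM ℂ (besselSymbol n |s|) χ').integrable (μ := volume)).norm.mul_const
      (2 ^ (|s| / 2))
    refine this.congr (Filter.Eventually.of_forall fun η => ?_)
    simp only [hw]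
    rw [SchwartzMap.smulLeftCLM_apply_apply (by fun_prop), norm_smul,
      Real.mul_rpow (by positivity) (by positivity)]
    simp only [besselSymbol, Complex.norm_real, Real.norm_eq_abs]
    rw [abs_of_nonneg (by positivity)]
    ring
  refine ⟨(∫ η, ‖χ' η‖ * w η) * ‖pairing n s‖, by positivity, fun φ ψ => ?_⟩
  have h1 : ∫ x, ψ x * smulS χ φ x = ∫ η, χ' η * 𝓕 (smulS φ ψ) η := by
    rw [← SchwartzMap.integral_fourier_mul_eq, hχ]
    refine integral_congr_ae (Filter.Eventually.of_forall fun x => ?_)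
    simp only [smulS_apply]
    ring
  rw [h1]
  refine (norm_integral_le_of_norm_le (hwint.mul_const
    (‖ofSchwartz s φ‖ * (‖pairing n s‖ * ‖ofSchwartz (-s) ψ‖)))
    (Filter.Eventually.of_forall fun η => ?_)).trans (le_of_eq ?_)
  · rw [norm_mul, mul_assoc]
    gcongr
    rw [← mul_assoc]
    exact norm_fourier_mul_le φ ψ η
  · rw [integral_mul_const]
    ring

/-- The bound extends from Schwartz functions to all of `W^{-s}` by density. The extremal `v` has
`freqInv` equal to the conjugate of `freq s u`, so that it has the norm of `u` and pairs with `u` to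
`‖u‖²`. -/
theorem norm_le_of_forall_pairing {C : ℝ} (hC : 0 ≤ C) (u : Sobolev n s)
    (h : ∀ ψ : 𝓢(Cn n, ℂ), ‖u.dist ψ‖ ≤ C * ‖ofSchwartz (-s) ψ‖) : ‖u‖ ≤ C := by
  have h1 : ∀ v : Sobolev n (-s), ‖pairing n s u v‖ ≤ C * ‖v‖ := fun v => by
    refine denseRange_ofSchwartz.induction_on (p := fun v => ‖pairing n s u v‖ ≤ C * ‖v‖) v
      (isClosed_le (pairing n s u).continuous.norm (by fun_prop)) fun ψ => ?_
    rw [ofSchwartzₗ_apply, pairing_ofSchwartz_right]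
    exact h ψ
  obtain ⟨v, hv⟩ := freqInv_surjective (s := -s) (star (freq s u))
  have hvn : ‖v‖ = ‖u‖ := by
    rw [← (freqInv (n := n) (-s)).norm_map, hv, ← (freq (n := n) s).norm_map u, Lp.norm_def,
      Lp.norm_def]
    congr 1
    refine eLpNorm_congr_norm_ae ?_
    filter_upwards [Lp.coeFn_star (freq s u)] with x hx
    rw [hx, Pi.star_apply, norm_star]
  have h2 : pairing n s u v = (‖u‖ : ℂ) ^ 2 := by
    have h3 : pairing n s u v = inner ℂ (freq s u) (freq s u) := by
      rw [pairing_apply, hv, L2.inner_def]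
      refine integral_congr_ae ?_
      filter_upwards [Lp.coeFn_star (freq s u)] with x hx
      rw [hx, Pi.star_apply, RCLike.inner_apply, RCLike.star_def]
    rw [h3, inner_self_eq_norm_sq_to_K, (freq s).norm_map]
    rfl
  have h4 := h1 v
  rw [h2, hvn, norm_pow, Complex.norm_real, norm_norm] at h4
  by_contra! hlt
  nlinarith [norm_nonneg u]

theorem exists_norm_smulS_le (s : ℝ) (χ : 𝓢(Cn n, ℂ)) : ∃ C, ∀ φ : 𝓢(Cn n, ℂ),
    ‖ofSchwartz s (smulS χ φ)‖ ≤ C * ‖ofSchwartz s φ‖ := by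
  obtain ⟨C, hC, h⟩ := exists_norm_integral_le s χ
  refine ⟨C, fun φ => norm_le_of_forall_pairing (by positivity) _ fun ψ => ?_⟩
  rw [dist_ofSchwartz]
  exact h φ ψ

/-- Multiplication by a Schwartz function on `W^s`. -/
def smulCLM (s : ℝ) (χ : 𝓢(Cn n, ℂ)) : Sobolev n s →L[ℂ] Sobolev n s :=
  (ofSchwartzₗ n s ∘ₗ (SchwartzMap.smulLeftCLM ℂ χ).toLinearMap).extendOfNorm (ofSchwartzₗ n s)

theorem smulCLM_ofSchwartz (χ φ : 𝓢(Cn n, ℂ)) :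
    smulCLM s χ (ofSchwartz s φ) = ofSchwartz s (smulS χ φ) :=
  LinearMap.extendOfNorm_eq denseRange_ofSchwartz (exists_norm_smulS_le s χ) φ

theorem continuous_dist_apply (ψ : 𝓢(Cn n, ℂ)) : Continuous fun u : Sobolev n s => u.dist ψ := by
  simp only [← pairing_ofSchwartz_right]
  exact ((pairing n s).flip (ofSchwartz (-s) ψ)).continuous

theorem dist_smulCLM (χ : 𝓢(Cn n, ℂ)) (u : Sobolev n s) :
    (smulCLM s χ u).dist = smulLeftCLM ℂ χ u.dist := by
  ext ψ
  refine denseRange_ofSchwartz.induction_on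
    (p := fun u => (smulCLM s χ u).dist ψ = smulLeftCLM ℂ χ u.dist ψ) u
    (isClosed_eq ((continuous_dist_apply ψ).comp (smulCLM s χ).continuous)
      (continuous_dist_apply (smulS χ ψ))) fun φ => ?_
  rw [ofSchwartzₗ_apply, smulCLM_ofSchwartz, smulLeftCLM_apply_apply, dist_ofSchwartz]
  rw [dist_ofSchwartz]
  refine integral_congr_ae (Filter.Eventually.of_forall fun x => ?_)
  change ψ x * (smulS χ φ) x = (smulS χ ψ) x * φ x
  simp only [smulS_apply]
  ring

/-- Multiplication is its own transpose, which lets a cutoff pass from one factor of Green's formula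
to the other. -/
theorem pairing_smulCLM (χ : 𝓢(Cn n, ℂ)) (u : Sobolev n s) (v : Sobolev n (-s)) :
    pairing n s (smulCLM s χ u) v = pairing n s u (smulCLM (-s) χ v) := by
  refine denseRange_ofSchwartz.induction_on
    (p := fun v => pairing n s (smulCLM s χ u) v = pairing n s u (smulCLM (-s) χ v)) v
    (isClosed_eq (pairing n s _).continuous
      ((pairing n s u).continuous.comp (smulCLM (-s) χ).continuous)) fun φ => ?_
  rw [ofSchwartzₗ_apply, smulCLM_ofSchwartz, pairing_ofSchwartz_right, pairing_ofSchwartz_right,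
    dist_smulCLM, smulLeftCLM_apply_apply]

end Sobolev

end SobolevDolbeault
end

noncomputable section
namespace SobolevDolbeault

open FourierTransform
open scoped ContDiff

variable {n : ℕ}

/-! ### Constant coefficient operators `∑ c_j ∂/∂z̄_j` -/

/-- The operator `∑ c_j ∂/∂z̄_j` on distributions. -/
def dop (c : Fin n → ℂ) : 𝓢'(Cn n, ℂ) →ₗ[ℂ] 𝓢'(Cn n, ℂ) := ∑ j, c j • dzbar j

/-- The operator `∑ c_j ∂/∂z̄_j` on Schwartz functions. -/
def dopS (c : Fin n → ℂ) : 𝓢(Cn n, ℂ) →ₗ[ℂ] 𝓢(Cn n, ℂ) :=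
  ∑ j, c j • ((1 / 2 : ℂ) •
    ((LineDeriv.lineDerivOpCLM ℂ 𝓢(Cn n, ℂ) (EuclideanSpace.single j (1 : ℂ))).toLinearMap +
      Complex.I •
        (LineDeriv.lineDerivOpCLM ℂ 𝓢(Cn n, ℂ)
          (EuclideanSpace.single j Complex.I)).toLinearMap))

theorem dop_apply_apply (c : Fin n → ℂ) (u : 𝓢'(Cn n, ℂ)) (φ : 𝓢(Cn n, ℂ)) :
    dop c u φ = -u (dopS c φ) := by
  simp only [dop, dopS, dzbar, LinearMap.sum_apply, LinearMap.smul_apply, LinearMap.add_apply,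
    ContinuousLinearMap.coe_coe, LineDeriv.lineDerivOpCLM_apply, map_sum, map_smul, map_add,
    _root_.sum_apply, _root_.smul_apply,
    _root_.add_apply, lineDerivOp_apply_apply, map_neg]
  rw [← Finset.sum_neg_distrib]
  refine Finset.sum_congr rfl fun j _ => ?_
  simp only [smul_eq_mul]
  ring

theorem dopS_apply (c : Fin n → ℂ) (φ : 𝓢(Cn n, ℂ)) (x : Cn n) :
    dopS c φ x = ∑ j, c j * ((1 / 2) * (fderiv ℝ φ x (EuclideanSpace.single j (1 : ℂ)) +
      Complex.I * fderiv ℝ φ x (EuclideanSpace.single j Complex.I))) := by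
  simp only [dopS, LinearMap.sum_apply, LinearMap.smul_apply, LinearMap.add_apply,
    ContinuousLinearMap.coe_coe, LineDeriv.lineDerivOpCLM_apply, _root_.sum_apply,
    _root_.smul_apply, _root_.add_apply, SchwartzMap.lineDerivOp_apply_eq_fderiv,
    smul_eq_mul]

theorem dopS_eq_zero_of_eventuallyEq_const {c : Fin n → ℂ} {φ : 𝓢(Cn n, ℂ)} {x : Cn n} {a : ℂ}
    (h : ∀ᶠ y in nhds x, φ y = a) : dopS c φ x = 0 := by
  have : fderiv ℝ φ x = 0 := by
    have h' : (φ : Cn n → ℂ) =ᶠ[nhds x] fun _ => a := h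
    rw [h'.fderiv_eq]
    simp
  simp [dopS_apply, this]

theorem tsupport_dopS_subset (c : Fin n → ℂ) (φ : 𝓢(Cn n, ℂ)) : tsupport (dopS c φ) ⊆ tsupport φ := by
  refine closure_minimal (fun x hx => ?_) (isClosed_tsupport _)
  by_contra h
  exact hx (dopS_eq_zero_of_eventuallyEq_const (a := 0) (notMem_tsupport_iff_eventuallyEq.mp h))

theorem isVanishingOn_dop {c : Fin n → ℂ} {u : 𝓢'(Cn n, ℂ)} {S : Set (Cn n)}
    (h : Distribution.IsVanishingOn u S) : Distribution.IsVanishingOn (dop c u) S := fun φ hφ => by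
  rw [dop_apply_apply, h _ ((tsupport_dopS_subset c φ).trans hφ), neg_zero]

open Sobolev in
theorem dopS_smulS (c : Fin n → ℂ) (χ φ : 𝓢(Cn n, ℂ)) :
    dopS c (smulS χ φ) = smulS χ (dopS c φ) + smulS (dopS c χ) φ := by
  ext x
  have h : ∀ m : Cn n, fderiv ℝ (smulS χ φ) x m =
      χ x * fderiv ℝ φ x m + fderiv ℝ χ x m * φ x := fun m => by
    have h1 : ((smulS χ φ : 𝓢(Cn n, ℂ)) : Cn n → ℂ) = χ * φ := funext fun y => smulS_apply χ φ y
    rw [h1, fderiv_mul χ.differentiableAt φ.differentiableAt]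
    simp only [_root_.add_apply, _root_.smul_apply, smul_eq_mul]
    ring
  simp only [_root_.add_apply, smulS_apply, dopS_apply, h]
  rw [Finset.mul_sum, Finset.sum_mul, ← Finset.sum_add_distrib]
  refine Finset.sum_congr rfl fun j _ => ?_
  ring

theorem dop_smul (c : Fin n → ℂ) (χ : 𝓢(Cn n, ℂ)) (u : 𝓢'(Cn n, ℂ)) :
    dop c (smulLeftCLM ℂ χ u) = smulLeftCLM ℂ χ (dop c u) + smulLeftCLM ℂ (dopS c χ) u := by
  ext φ
  rw [_root_.add_apply, dop_apply_apply, smulLeftCLM_apply_apply, smulLeftCLM_apply_apply,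
    smulLeftCLM_apply_apply, dop_apply_apply]
  have := dopS_smulS c χ φ
  simp only [Sobolev.smulS] at this
  rw [this, map_add]
  ring

/-- The symbol of `dop c`. -/
def dopSymbol (c : Fin n → ℂ) (ξ : Cn n) : ℂ :=
  ∑ j, (c j * (1 / 2) * (2 * Real.pi * Complex.I)) *
    ((inner ℝ ξ (EuclideanSpace.single j (1 : ℂ)) : ℝ) +
      Complex.I * (inner ℝ ξ (EuclideanSpace.single j Complex.I) : ℝ))

@[fun_prop]
theorem dopSymbol_hasTemperateGrowth (c : Fin n → ℂ) : (dopSymbol c).HasTemperateGrowth := by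
  unfold dopSymbol
  fun_prop

theorem smulLeftCLM_dopSymbol (c : Fin n → ℂ) (u : 𝓢'(Cn n, ℂ)) :
    smulLeftCLM ℂ (dopSymbol c) u = ∑ j, (c j * (1 / 2) * (2 * Real.pi * Complex.I)) •
      (smulLeftCLM ℂ (fun ξ => ((inner ℝ ξ (EuclideanSpace.single j (1 : ℂ)) : ℝ) : ℂ)) u +
        Complex.I • smulLeftCLM ℂ
          (fun ξ => ((inner ℝ ξ (EuclideanSpace.single j Complex.I) : ℝ) : ℂ)) u) := by
  have h1 : dopSymbol c = fun ξ => ∑ j, ((c j * (1 / 2) * (2 * Real.pi * Complex.I)) •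
    ((fun ξ : Cn n => ((inner ℝ ξ (EuclideanSpace.single j (1 : ℂ)) : ℝ) : ℂ)) +
      Complex.I • (fun ξ => ((inner ℝ ξ (EuclideanSpace.single j Complex.I) : ℝ) : ℂ)))) ξ := by
    ext ξ; simp [dopSymbol]
  have hr : ∀ m : Cn n, (fun ξ : Cn n => ((inner ℝ ξ m : ℝ) : ℂ)).HasTemperateGrowth := fun m => by
    fun_prop
  have hs : ∀ m : Cn n,
      (Complex.I • (fun ξ : Cn n => ((inner ℝ ξ m : ℝ) : ℂ))).HasTemperateGrowth := fun m =>
    (Function.HasTemperateGrowth.const Complex.I).smul (hr m)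
  rw [h1, smulLeftCLM_sum]
  · rw [_root_.sum_apply]
    refine Finset.sum_congr rfl fun j _ => ?_
    rw [smulLeftCLM_smul ((hr _).add (hs _)), smulLeftCLM_add (hr _) (hs _), smulLeftCLM_smul (hr _)]
    rfl
  · exact fun j _ => (Function.HasTemperateGrowth.const _).smul ((hr _).add (hs _))

theorem fourier_dop (c : Fin n → ℂ) (u : 𝓢'(Cn n, ℂ)) :
    𝓕 (dop c u) = smulLeftCLM ℂ (dopSymbol c) (𝓕 u) := by
  rw [smulLeftCLM_dopSymbol]
  change fourierCLM ℂ 𝓢'(Cn n, ℂ) (dop c u) = _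
  simp only [dop, dzbar, LinearMap.sum_apply, LinearMap.smul_apply, LinearMap.add_apply,
    ContinuousLinearMap.coe_coe, LineDeriv.lineDerivOpCLM_apply, map_sum, map_smul, map_add]
  refine Finset.sum_congr rfl fun j _ => ?_
  simp only [fourierCLM_apply, fourier_lineDerivOp_eq]
  module

theorem fourierInv_dop (c : Fin n → ℂ) (u : 𝓢'(Cn n, ℂ)) :
    𝓕⁻ (dop c u) = -smulLeftCLM ℂ (dopSymbol c) (𝓕⁻ u) := by
  rw [smulLeftCLM_dopSymbol]
  change fourierInvCLM ℂ 𝓢'(Cn n, ℂ) (dop c u) = _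
  simp only [dop, dzbar, LinearMap.sum_apply, LinearMap.smul_apply, LinearMap.add_apply,
    ContinuousLinearMap.coe_coe, LineDeriv.lineDerivOpCLM_apply, map_sum, map_smul, map_add]
  rw [← Finset.sum_neg_distrib]
  refine Finset.sum_congr rfl fun j _ => ?_
  simp only [fourierInvCLM_apply, fourierInv_lineDerivOp_eq]
  module

/-! ### Green's formula on `ℂⁿ` -/

/-- The products `p i * H i` need not be in `L²`, only locally integrable; that suffices for testing
against smooth functions of compact support. -/
theorem ae_eq_sum_mul_of_dist_eq {ι : Type*} [Fintype ι]
    (G : Lp ℂ 2 (volume : Measure (Cn n))) (H : ι → Lp ℂ 2 (volume : Measure (Cn n)))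
    (p : ι → Cn n → ℂ) (hp : ∀ i, (p i).HasTemperateGrowth)
    (h : (G : 𝓢'(Cn n, ℂ)) = ∑ i, smulLeftCLM ℂ (p i) (H i : 𝓢'(Cn n, ℂ))) :
    ∀ᵐ ξ, G ξ = ∑ i, p i ξ * H i ξ := by
  have hloc : ∀ f : Lp ℂ 2 (volume : Measure (Cn n)), LocallyIntegrable f volume := fun f =>
    (Lp.memLp f).locallyIntegrable one_le_two
  have hmul : ∀ i, LocallyIntegrable (fun ξ => p i ξ * H i ξ) volume := fun i => by
    have := (hloc (H i)).locallyIntegrableOn Set.univ |>.continuousOn_mul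
      (hp i).1.continuous.continuousOn isOpen_univ.isLocallyClosed
    exact locallyIntegrableOn_univ.mp this
  have key : ∀ᵐ ξ, G ξ - ∑ i, p i ξ * H i ξ = 0 := by
    refine ae_eq_zero_of_integral_contDiff_smul_eq_zero
      ((hloc G).sub (locallyIntegrable_finsetSum _ fun i _ => hmul i)) fun g hg hgc => ?_
    have hg₁ : HasCompactSupport (Complex.ofRealCLM ∘ g) := hgc.comp_left rfl
    have hg₂ : ContDiff ℝ ∞ (Complex.ofRealCLM ∘ g) := by fun_prop
    set φ : 𝓢(Cn n, ℂ) := hg₁.toSchwartzMap hg₂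
    have hφ : ∀ x, φ x = (g x : ℂ) := fun x => rfl
    have hint : ∀ (f : Lp ℂ 2 (volume : Measure (Cn n))) (ψ : 𝓢(Cn n, ℂ)),
        Integrable (fun x => ψ x • f x) volume := fun f ψ =>
      (ψ.memLp 2 volume).integrable_mul (Lp.memLp f)
    have h1 := congrArg (fun u : 𝓢'(Cn n, ℂ) => u φ) h
    simp only [_root_.sum_apply, smulLeftCLM_apply_apply,
      Lp.toTemperedDistribution_apply] at h1
    rw [← integral_finsetSum _ fun i _ => hint _ _, ← sub_eq_zero,
      ← integral_sub (hint _ _) (integrable_finsetSum _ fun i _ => hint _ _)] at h1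
    rw [← h1]
    refine integral_congr_ae (Filter.Eventually.of_forall fun x => ?_)
    simp only [SchwartzMap.smulLeftCLM_apply_apply (hp _), hφ, smul_eq_mul, Complex.real_smul,
      mul_sub, Finset.mul_sum]
    congr 1
    exact Finset.sum_congr rfl fun i _ => by ring
  filter_upwards [key] with ξ hξ
  exact sub_eq_zero.mp hξ

namespace Sobolev

variable {s : ℝ} {A B : Type*} [Fintype A] [Fintype B]

theorem freq_eq_of_dist_eq_sum_dop (c : A → Fin n → ℂ) (F : A → Sobolev n s) (K : Sobolev n s)
    (h : K.dist = ∑ a, dop (c a) (F a).dist) :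
    ∀ᵐ ξ, freq s K ξ = ∑ a, dopSymbol (c a) ξ * freq s (F a) ξ := by
  refine ae_eq_sum_mul_of_dist_eq _ _ _ (fun a => by fun_prop) ?_
  rw [← smul_fourier_dist, h]
  change smulLeftCLM ℂ _ (fourierCLM ℂ 𝓢'(Cn n, ℂ) _) = _
  rw [map_sum, map_sum]
  refine Finset.sum_congr rfl fun a _ => ?_
  rw [fourierCLM_apply, fourier_dop, ← smul_fourier_dist,
    smulLeftCLM_smulLeftCLM_apply (by fun_prop) (by fun_prop),
    smulLeftCLM_smulLeftCLM_apply (by fun_prop) (by fun_prop), mul_comm]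

/-- The symbol is linear in `ξ`, so replacing the Fourier transform by its inverse changes its sign.
This is the sign in Green's formula. -/
theorem freqInv_eq_of_dist_eq_sum_dop (c : A → Fin n → ℂ) (F : A → Sobolev n s) (K : Sobolev n s)
    (h : K.dist = ∑ a, dop (c a) (F a).dist) :
    ∀ᵐ ξ, freqInv s K ξ = -∑ a, dopSymbol (c a) ξ * freqInv s (F a) ξ := by
  have := ae_eq_sum_mul_of_dist_eq (freqInv s K) (fun a => freqInv s (F a))
    (fun a => -dopSymbol (c a)) (fun a => by fun_prop) ?_
  · filter_upwards [this] with ξ hξ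
    simp [hξ, Finset.sum_neg_distrib]
  rw [← smul_fourierInv_dist, h]
  change smulLeftCLM ℂ _ (fourierInvCLM ℂ 𝓢'(Cn n, ℂ) _) = _
  rw [map_sum, map_sum]
  refine Finset.sum_congr rfl fun a _ => ?_
  rw [fourierInvCLM_apply, fourierInv_dop, ← smul_fourierInv_dist, map_neg,
    smulLeftCLM_neg (by fun_prop)]
  change _ = -(smulLeftCLM ℂ _ _)
  rw [smulLeftCLM_smulLeftCLM_apply (by fun_prop) (by fun_prop),
    smulLeftCLM_smulLeftCLM_apply (by fun_prop) (by fun_prop), mul_comm]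

theorem integrable_freq_mul (u : Sobolev n s) (v : Sobolev n (-s)) :
    Integrable (fun ξ => freq s u ξ * freqInv (-s) v ξ) volume :=
  (Lp.memLp _).integrable_mul (Lp.memLp _)

/-- Green's formula on `ℂⁿ` for a first order system and its transpose. -/
theorem green_univ (c : B → A → Fin n → ℂ) (F : A → Sobolev n s) (K : B → Sobolev n s)
    (u : B → Sobolev n (-s)) (v : A → Sobolev n (-s))
    (hK : ∀ b, (K b).dist = ∑ a, dop (c b a) (F a).dist)
    (hv : ∀ a, (v a).dist = ∑ b, dop (c b a) (u b).dist) :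
    ∑ b, pairing n s (K b) (u b) = -∑ a, pairing n s (F a) (v a) := by
  have h1 : ∀ᵐ ξ, ∀ b, freq s (K b) ξ = ∑ a, dopSymbol (c b a) ξ * freq s (F a) ξ :=
    ae_all_iff.mpr fun b => freq_eq_of_dist_eq_sum_dop (c b) F (K b) (hK b)
  have h2 : ∀ᵐ ξ, ∀ a, freqInv (-s) (v a) ξ = -∑ b, dopSymbol (c b a) ξ * freqInv (-s) (u b) ξ :=
    ae_all_iff.mpr fun a => freqInv_eq_of_dist_eq_sum_dop (fun b => c b a) u (v a) (hv a)
  simp only [pairing_apply]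
  rw [← integral_finsetSum _ fun b _ => integrable_freq_mul _ _,
    ← integral_finsetSum _ fun a _ => integrable_freq_mul _ _, ← integral_neg]
  refine integral_congr_ae ?_
  filter_upwards [h1, h2] with ξ h1 h2
  -- The identity holds pointwise in `ξ`. The individual products with a symbol may fail to be
  -- integrable, so the double sum is exchanged under a single integral.
  simp only [h1, h2, Finset.sum_mul, mul_neg, Finset.mul_sum, Finset.sum_neg_distrib, neg_neg]
  rw [Finset.sum_comm]
  exact Finset.sum_congr rfl fun a _ => Finset.sum_congr rfl fun b _ => by ring

end Sobolev

end SobolevDolbeault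
end

noncomputable section
namespace SobolevDolbeault

open FourierTransform Filter Topology
open scoped ContDiff Manifold

variable {n : ℕ}

/-! ### Cutoff functions -/

theorem exists_schwartz_partition {ι : Type} [Fintype ι] {K : Set (Cn n)} (hK : IsCompact K)
    (U : ι → Set (Cn n)) (hU : ∀ i, IsOpen (U i)) (hKU : K ⊆ ⋃ i, U i) :
    ∃ χ : ι → 𝓢(Cn n, ℂ), (∀ i, tsupport (χ i) ⊆ U i) ∧ (∀ i, HasCompactSupport (χ i)) ∧
      ∀ x ∈ K, ∀ᶠ y in 𝓝 x, ∑ i, χ i y = 1 := by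
  -- The partition is taken over a thickening of `K`, so that the sum is one near each point of `K`;
  -- the covering sets are cut down to a bounded set to make the supports compact.
  obtain ⟨δ, hδ, hKδ⟩ := hK.exists_cthickening_subset_open (isOpen_iUnion hU) hKU
  have hbd : Bornology.IsBounded (Metric.thickening (δ + 1) K) := hK.isBounded.thickening
  obtain ⟨ρ, hρ⟩ := SmoothPartitionOfUnity.exists_isSubordinate 𝓘(ℝ, Cn n)
    (s := Metric.cthickening δ K) Metric.isClosed_cthickening
    (fun i => U i ∩ Metric.thickening (δ + 1) K)
    (fun i => (hU i).inter Metric.isOpen_thickening) (by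
      rw [← Set.iUnion_inter]
      exact Set.subset_inter hKδ
        (Metric.cthickening_subset_thickening' (by linarith) (by linarith) K))
  have hc : ∀ i, HasCompactSupport (ρ i) := fun i =>
    Metric.isCompact_of_isClosed_isBounded (isClosed_tsupport _)
      (hbd.subset ((hρ i).trans Set.inter_subset_right))
  have hc' : ∀ i, HasCompactSupport (Complex.ofRealCLM ∘ ρ i) := fun i => (hc i).comp_left rfl
  have hs : ∀ i, ContDiff ℝ ∞ (Complex.ofRealCLM ∘ ρ i) := fun i =>
    Complex.ofRealCLM.contDiff.comp (ρ i).contMDiff.contDiff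
  refine ⟨fun i => (hc' i).toSchwartzMap (hs i), fun i => ?_, hc', fun x hx => ?_⟩
  · exact (closure_mono (Function.support_comp_subset (g := Complex.ofRealCLM) (map_zero _) (ρ i))).trans
      ((hρ i).trans Set.inter_subset_left)
  · have : Metric.cthickening δ K ∈ 𝓝 x :=
      mem_of_superset (Metric.isOpen_thickening.mem_nhds (Metric.self_subset_thickening hδ K hx))
        (Metric.thickening_subset_cthickening δ K)
    filter_upwards [this] with y hy
    have h1 := ρ.sum_eq_one hy
    rw [finsum_eq_sum_of_fintype] at h1
    change ∑ i, ((ρ i y : ℝ) : ℂ) = 1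
    rw [← Complex.ofReal_sum, h1, Complex.ofReal_one]

/-- Vanishing of `ψ` on `K` alone would not do, as the distribution may involve derivatives;
vanishing near `K` keeps the support of `ψ φ` away from `K`. -/
theorem smulLeftCLM_eq_zero_of_isVanishingOn {u : 𝓢'(Cn n, ℂ)} {K : Set (Cn n)}
    (hu : Distribution.IsVanishingOn u Kᶜ) {ψ : 𝓢(Cn n, ℂ)} (hψ : ∀ x ∈ K, ∀ᶠ y in 𝓝 x, ψ y = 0) :
    smulLeftCLM ℂ ψ u = 0 := by
  ext φ
  refine hu (SchwartzMap.smulLeftCLM ℂ ψ φ) fun x hx hxK => ?_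
  refine notMem_tsupport_iff_eventuallyEq.mpr ?_ hx
  filter_upwards [hψ x hxK] with y hy
  rw [SchwartzMap.smulLeftCLM_apply_apply ψ.hasTemperateGrowth, hy, zero_smul, Pi.zero_apply]

theorem smulLeftCLM_eq_self_of_isVanishingOn {u : 𝓢'(Cn n, ℂ)} {K : Set (Cn n)}
    (hu : Distribution.IsVanishingOn u Kᶜ) {χ : 𝓢(Cn n, ℂ)} (hχ : ∀ x ∈ K, ∀ᶠ y in 𝓝 x, χ y = 1) :
    smulLeftCLM ℂ χ u = u := by
  ext φ
  rw [smulLeftCLM_apply_apply, ← sub_eq_zero, ← map_sub]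
  refine hu _ fun x hx hxK => ?_
  refine notMem_tsupport_iff_eventuallyEq.mpr ?_ hx
  filter_upwards [hχ x hxK] with y hy
  rw [_root_.sub_apply, SchwartzMap.smulLeftCLM_apply_apply χ.hasTemperateGrowth, hy, one_smul,
    sub_self, Pi.zero_apply]

theorem isVanishingOn_smulLeftCLM_of_tsupport {u : 𝓢'(Cn n, ℂ)} {S : Set (Cn n)}
    (hu : Distribution.IsVanishingOn u Sᶜ) (χ : 𝓢(Cn n, ℂ)) :
    Distribution.IsVanishingOn (smulLeftCLM ℂ χ u) (tsupport χ ∩ S)ᶜ := fun φ hφ => by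
  refine hu (SchwartzMap.smulLeftCLM ℂ χ φ) fun x hx hxS => ?_
  have h1 : (SchwartzMap.smulLeftCLM ℂ χ φ : Cn n → ℂ) = fun x => χ x • φ x :=
    funext fun x => SchwartzMap.smulLeftCLM_apply_apply χ.hasTemperateGrowth φ x
  rw [h1] at hx
  exact hφ (tsupport_smul_subset_right _ _ hx) ⟨tsupport_smul_subset_left _ _ hx, hxS⟩

theorem isVanishingOn_sum {ι : Type*} (t : Finset ι) {u : ι → 𝓢'(Cn n, ℂ)} {S : Set (Cn n)}
    (hu : ∀ i ∈ t, Distribution.IsVanishingOn (u i) S) :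
    Distribution.IsVanishingOn (∑ i ∈ t, u i : 𝓢'(Cn n, ℂ)) S := fun φ hφ => by
  rw [_root_.sum_apply]
  exact Finset.sum_eq_zero fun i hi => hu i hi φ hφ

/-! ### Translation -/

/-- Translation by `h`. -/
def translate (h : Cn n) : 𝓢'(Cn n, ℂ) →L[ℂ] 𝓢'(Cn n, ℂ) :=
  PointwiseConvergenceCLM.precomp ℂ (SchwartzMap.compSubConstCLM ℂ (-h))

theorem translate_apply (h : Cn n) (u : 𝓢'(Cn n, ℂ)) (φ : 𝓢(Cn n, ℂ)) :
    translate h u φ = u (SchwartzMap.compSubConstCLM ℂ (-h) φ) := rfl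

theorem dopS_compSubConst (c : Fin n → ℂ) (h : Cn n) (φ : 𝓢(Cn n, ℂ)) :
    dopS c (SchwartzMap.compSubConstCLM ℂ h φ) = SchwartzMap.compSubConstCLM ℂ h (dopS c φ) := by
  ext x
  have h1 : (SchwartzMap.compSubConstCLM ℂ h φ : Cn n → ℂ) = fun x => φ (x - h) :=
    funext fun x => SchwartzMap.compSubConstCLM_apply φ h x
  rw [SchwartzMap.compSubConstCLM_apply, dopS_apply, dopS_apply, h1]
  simp only [fderiv_comp_sub]

theorem dop_translate (c : Fin n → ℂ) (h : Cn n) (u : 𝓢'(Cn n, ℂ)) :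
    dop c (translate h u) = translate h (dop c u) := by
  ext φ
  rw [dop_apply_apply, translate_apply, translate_apply, dop_apply_apply, dopS_compSubConst]

theorem isVanishingOn_translate {u : 𝓢'(Cn n, ℂ)} {K : Set (Cn n)}
    (hu : Distribution.IsVanishingOn u Kᶜ) (h : Cn n) :
    Distribution.IsVanishingOn (translate h u) ((fun x => x + h) '' K)ᶜ := fun φ hφ => by
  rw [translate_apply]
  refine hu _ fun x hx hxK => ?_
  have h1 : (SchwartzMap.compSubConstCLM ℂ (-h) φ : Cn n → ℂ) = φ ∘ Homeomorph.addRight h := by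
    ext y
    simp [SchwartzMap.compSubConstCLM_apply]
  rw [h1, tsupport_comp_eq_preimage] at hx
  exact hφ hx ⟨x, hxK, rfl⟩

namespace Sobolev

variable {s : ℝ}

theorem freq_ofSchwartz_translate (h : Cn n) (φ : 𝓢(Cn n, ℂ)) :
    ∀ᵐ ξ, freq s (ofSchwartz s (SchwartzMap.compSubConstCLM ℂ (-h) φ)) ξ =
      (Real.fourierChar (inner ℝ ξ h) : ℂ) * freq s (ofSchwartz s φ) ξ := by
  rw [freq_ofSchwartz, freq_ofSchwartz]
  filter_upwards [SchwartzMap.coeFn_toLp (SchwartzMap.smulLeftCLM ℂ (besselSymbol n s)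
      (𝓕 (SchwartzMap.compSubConstCLM ℂ (-h) φ))) 2 volume,
    SchwartzMap.coeFn_toLp (SchwartzMap.smulLeftCLM ℂ (besselSymbol n s) (𝓕 φ)) 2 volume]
    with ξ h1 h2
  rw [h1, h2, SchwartzMap.smulLeftCLM_apply_apply (by fun_prop),
    SchwartzMap.smulLeftCLM_apply_apply (by fun_prop), smul_eq_mul, smul_eq_mul, mul_left_comm]
  congr 1
  rw [SchwartzMap.fourier_coe, SchwartzMap.fourier_coe, Real.fourier_eq, Real.fourier_eq,
    ← integral_const_mul, ← integral_sub_right_eq_self _ h]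
  refine integral_congr_ae (Eventually.of_forall fun x => ?_)
  simp only [SchwartzMap.compSubConstCLM_apply, Circle.smul_def, smul_eq_mul, sub_neg_eq_add,
    sub_add_cancel, inner_sub_left]
  rw [← mul_assoc, ← Circle.coe_mul, ← AddChar.map_add_eq_mul, real_inner_comm h ξ]
  congr 4
  ring

/-- Translation multiplies the transform by a character of modulus one, so it preserves the Sobolev
space, and its effect on the pairing is explicit. -/
theorem exists_translate (h : Cn n) (v : Sobolev n (-s)) : ∃ w : Sobolev n (-s),
    w.dist = translate h v.dist ∧ ∀ u : Sobolev n s, pairing n s u w =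
      ∫ ξ, (Real.fourierChar (inner ℝ ξ h) : ℂ) * (freq s u ξ * freqInv (-s) v ξ) := by
  have hm : MemLp (fun ξ => (Real.fourierChar (inner ℝ ξ h) : ℂ) * freqInv (-s) v ξ) 2
      (volume : Measure (Cn n)) := by
    refine (Lp.memLp (freqInv (-s) v)).congr_norm ?_ ?_
    · exact (Continuous.aestronglyMeasurable (by fun_prop)).mul (Lp.aestronglyMeasurable _)
    · exact Eventually.of_forall fun ξ => by simp [Circle.norm_coe]
  obtain ⟨w, hw⟩ := freqInv_surjective (s := -s) hm.toLp
  have hp : ∀ u : Sobolev n s, pairing n s u w =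
      ∫ ξ, (Real.fourierChar (inner ℝ ξ h) : ℂ) * (freq s u ξ * freqInv (-s) v ξ) := fun u => by
    rw [pairing_apply, hw]
    refine integral_congr_ae ?_
    filter_upwards [hm.coeFn_toLp] with ξ hξ
    rw [hξ]
    ring
  refine ⟨w, ?_, hp⟩
  ext φ
  rw [translate_apply, ← pairing_ofSchwartz_left (s := s), ← pairing_ofSchwartz_left (s := s), hp,
    pairing_apply]
  refine integral_congr_ae ?_
  filter_upwards [freq_ofSchwartz_translate (s := s) h φ] with ξ hξ
  rw [hξ]
  ring

/-- Weak continuity of translations, by dominated convergence: the characters have modulus one and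
tend to `1`. -/
theorem tendsto_integral_fourierChar (w : Cn n) (u : Sobolev n s) (v : Sobolev n (-s)) :
    Tendsto (fun t : ℝ => ∫ ξ, (Real.fourierChar (inner ℝ ξ (t • w)) : ℂ) *
      (freq s u ξ * freqInv (-s) v ξ)) (𝓝 0) (𝓝 (pairing n s u v)) := by
  rw [pairing_apply]
  refine tendsto_integral_filter_of_dominated_convergence
    (fun ξ => ‖freq s u ξ * freqInv (-s) v ξ‖) (Eventually.of_forall fun t => ?_)
    (Eventually.of_forall fun t => Eventually.of_forall fun ξ => ?_)
    (integrable_freq_mul u v).norm (Eventually.of_forall fun ξ => ?_)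
  · exact (Continuous.aestronglyMeasurable (by fun_prop)).mul
      (integrable_freq_mul u v).aestronglyMeasurable
  · simp [Circle.norm_coe]
  · have : Continuous fun t : ℝ => (Real.fourierChar (inner ℝ ξ (t • w)) : ℂ) *
      (freq s u ξ * freqInv (-s) v ξ) := by fun_prop
    have h := this.tendsto 0
    simpa using h

end Sobolev

end SobolevDolbeault
end

/-! ### Green's formula on a Lipschitz domain -/

noncomputable section
namespace SobolevDolbeault

open Filter Topology

variable {n : ℕ}

/-- Near each point of `D̄` there is a direction in which compact pieces of `D̄` can be pushed into
`D`. -/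
theorem exists_inward_translation {D : Set (Cn n)} (hD : IsOpen D) (hL : HasLipschitzBoundary D)
    {x : Cn n} (hx : x ∈ closure D) : ∃ (U : Set (Cn n)) (w : Cn n), IsOpen U ∧ x ∈ U ∧
      ∀ C, IsCompact C → C ⊆ U → C ⊆ closure D →
        ∀ᶠ t : ℝ in 𝓝[>] 0, (fun y => y + t • w) '' C ⊆ D := by
  by_cases hxD : x ∈ D
  · refine ⟨D, 0, hD, hxD, fun C _ hCD _ => Eventually.of_forall fun t => ?_⟩
    simpa using hCD
  obtain ⟨U, v, φ, K, hU, hxU, hv, hφ, hUD⟩ := hL x ⟨hx, by rwa [hD.interior_eq]⟩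
  -- Moving along `-v` lowers the height over the graph and leaves the other coordinates fixed, so
  -- one direction works for the whole neighbourhood.
  refine ⟨U, -v, hU, hxU, fun C hC hCU hCD => ?_⟩
  obtain ⟨ε, hε, hεU⟩ := hC.exists_cthickening_subset_open hU hCU
  -- Points of `D̄` in `U` lie on or below the graph, since being strictly above is an open
  -- condition; any positive shift then puts them strictly below.
  have hcl : ∀ y ∈ C, inner ℝ v y ≤ φ (y - inner ℝ v y • v) := fun y hy => by
    by_contra! hlt
    have hcont : Continuous fun z : Cn n => φ (z - inner ℝ v z • v) := by
      have := hφ.continuous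
      fun_prop
    have hopen : IsOpen {z : Cn n | φ (z - inner ℝ v z • v) < inner ℝ v z} :=
      isOpen_lt hcont (by fun_prop)
    obtain ⟨z, ⟨hz1, hz2⟩, hzD⟩ :=
      mem_closure_iff.mp (hCD hy) _ (hopen.inter hU) ⟨hlt, hCU hy⟩
    exact absurd ((hUD z hz2).mp hzD) (not_lt.mpr hz1.le)
  filter_upwards [Ioo_mem_nhdsGT hε] with t ht
  rintro _ ⟨y, hy, rfl⟩
  have hyU : y + t • -v ∈ U := hεU (Metric.mem_cthickening_of_dist_le _ y _ _ hy (by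
    rw [dist_eq_norm, add_sub_cancel_left, norm_smul, norm_neg, hv, mul_one, Real.norm_eq_abs,
      abs_of_pos ht.1]
    exact ht.2.le))
  refine (hUD _ hyU).mpr ?_
  have h1 : inner ℝ v (y + t • -v) = inner ℝ v y - t := by
    rw [inner_add_right, inner_smul_right, inner_neg_right, real_inner_self_eq_norm_sq, hv]
    ring
  have h2 : y + t • -v - (inner ℝ v y - t) • v = y - inner ℝ v y • v := by module
  rw [h1, h2]
  linarith [hcl y hy, ht.1]

namespace Sobolev

variable {s : ℝ} {A B : Type*} [Fintype A] [Fintype B] {D : Set (Cn n)}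

theorem smulCLM_eq_self {u : Sobolev n s} {C : Set (Cn n)}
    (hu : Distribution.IsVanishingOn u.dist Cᶜ) {χ : 𝓢(Cn n, ℂ)}
    (hχ : ∀ x ∈ C, ∀ᶠ y in 𝓝 x, χ y = 1) : smulCLM s χ u = u :=
  dist_injective (by rw [dist_smulCLM, smulLeftCLM_eq_self_of_isVanishingOn hu hχ])

theorem smulCLM_dopS_eq_zero {u : Sobolev n s} {C : Set (Cn n)}
    (hu : Distribution.IsVanishingOn u.dist Cᶜ) {χ : 𝓢(Cn n, ℂ)}
    (hχ : ∀ x ∈ C, ∀ᶠ y in 𝓝 x, χ y = 1) (c : Fin n → ℂ) : smulCLM s (dopS c χ) u = 0 :=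
  dist_injective (by
    rw [dist_smulCLM, map_zero]
    refine smulLeftCLM_eq_zero_of_isVanishingOn hu fun x hx => ?_
    filter_upwards [(hχ x hx).eventually_nhds] with y hy
    exact dopS_eq_zero_of_eventuallyEq_const hy)

/-- Green's formula when the second factor has compact support in `D`. -/
theorem green_of_compact (c : B → A → Fin n → ℂ) (F : A → Sobolev n s)
    (K : B → Sobolev n s) (u : B → Sobolev n (-s)) (v : A → Sobolev n (-s)) (hD : IsOpen D)
    (hK : ∀ b, Distribution.IsVanishingOn ((K b).dist - ∑ a, dop (c b a) (F a).dist) D)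
    (hv : ∀ a, (v a).dist = ∑ b, dop (c b a) (u b).dist) {C : Set (Cn n)} (hC : IsCompact C)
    (hCD : C ⊆ D) (hu : ∀ b, Distribution.IsVanishingOn (u b).dist Cᶜ) :
    ∑ b, pairing n s (K b) (u b) = -∑ a, pairing n s (F a) (v a) := by
  obtain ⟨χ, hχD, -, hχ⟩ := exists_schwartz_partition (ι := Unit) hC (fun _ => D) (fun _ => hD)
    (hCD.trans (Set.subset_iUnion (fun _ : Unit => D) ()))
  simp only [Finset.univ_unique, Finset.sum_singleton] at hχ
  have hvC : ∀ a, Distribution.IsVanishingOn (v a).dist Cᶜ := fun a => by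
    rw [hv]
    exact isVanishingOn_sum _ fun b _ => isVanishingOn_dop (hu b)
  -- Multiplied by a cutoff that is `1` near `C`, the equation on `D` becomes one on `ℂⁿ`, at the
  -- price of terms with derivatives of the cutoff. Those vanish near `C` and do not meet `u`.
  have h := green_univ c (fun a => smulCLM s (χ default) (F a))
    (fun b => smulCLM s (χ default) (K b) + ∑ a, smulCLM s (dopS (c b a) (χ default)) (F a)) u v
    (fun b => ?_) hv
  · simp only [map_add, map_sum, _root_.add_apply, _root_.sum_apply, pairing_smulCLM,
      smulCLM_eq_self (hu _) hχ, smulCLM_eq_self (hvC _) hχ, smulCLM_dopS_eq_zero (hu _) hχ,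
      map_zero, Finset.sum_const_zero, add_zero] at h
    exact h
  · have h1 : smulLeftCLM ℂ (χ default) ((K b).dist - ∑ a, dop (c b a) (F a).dist) = 0 := by
      ext φ
      refine hK b (SchwartzMap.smulLeftCLM ℂ (χ default) φ) ?_
      have h2 : (SchwartzMap.smulLeftCLM ℂ (χ default) φ : Cn n → ℂ) = fun x => χ default x • φ x :=
        funext fun x => SchwartzMap.smulLeftCLM_apply_apply (χ default).hasTemperateGrowth φ x
      rw [h2]
      exact (tsupport_smul_subset_left _ _).trans (hχD default)
    rw [map_sub, sub_eq_zero, map_sum] at h1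
    simp only [map_add, map_sum, dist_smulCLM, dop_smul, h1, Finset.sum_add_distrib]

/-- **Green's formula** on a domain with Lipschitz boundary, for a first order system and its
transpose: no boundary term appears since `u` and its image `v` extend by zero. -/
theorem green (c : B → A → Fin n → ℂ) (F : A → Sobolev n s)
    (K : B → Sobolev n s) (u : B → Sobolev n (-s)) (v : A → Sobolev n (-s)) (hD : IsOpen D)
    (hb : Bornology.IsBounded D) (hL : HasLipschitzBoundary D)
    (hK : ∀ b, Distribution.IsVanishingOn ((K b).dist - ∑ a, dop (c b a) (F a).dist) D)
    (hv : ∀ a, (v a).dist = ∑ b, dop (c b a) (u b).dist)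
    (hu : ∀ b, Distribution.IsVanishingOn (u b).dist (closure D)ᶜ) :
    ∑ b, pairing n s (K b) (u b) = -∑ a, pairing n s (F a) (v a) := by
  have hcpt : IsCompact (closure D) := hb.isCompact_closure
  have hvD : ∀ a, Distribution.IsVanishingOn (v a).dist (closure D)ᶜ := fun a => by
    rw [hv]
    exact isVanishingOn_sum _ fun b _ => isVanishingOn_dop (hu b)
  choose U w hU hxU hpush using fun x : closure D => exists_inward_translation hD hL x.2
  obtain ⟨t, ht⟩ := hcpt.elim_finite_subcover U hU
    fun x hx => Set.mem_iUnion.mpr ⟨⟨x, hx⟩, hxU ⟨x, hx⟩⟩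
  obtain ⟨χ, hχU, hχc, hχ⟩ := exists_schwartz_partition (ι := t) hcpt (fun i => U i) (fun i => hU i)
    (by simpa [Set.iUnion_subtype] using ht)
  -- Green's formula for the piece `χ i • u`, whose image under the transposed system is `χ i • v`
  -- plus the terms where a derivative falls on `χ i`.
  have hloc : ∀ i : t, ∑ b, pairing n s (K b) (smulCLM (-s) (χ i) (u b)) =
      -∑ a, pairing n s (F a) (smulCLM (-s) (χ i) (v a) +
        ∑ b, smulCLM (-s) (dopS (c b a) (χ i)) (u b)) := fun i => by
    set C : Set (Cn n) := tsupport (χ i) ∩ closure D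
    have hC : IsCompact C := (hχc i).inter_right isClosed_closure
    have hev := hpush i C hC (Set.inter_subset_left.trans (hχU i)) Set.inter_subset_right
    -- For small `r > 0` the translated piece has compact support in `D`, and constant coefficient
    -- operators commute with translation.
    have hcongr : ∀ᶠ r : ℝ in 𝓝[>] 0,
        ∑ b, ∫ ξ, (Real.fourierChar (inner ℝ ξ (r • w i)) : ℂ) *
            (freq s (K b) ξ * freqInv (-s) (smulCLM (-s) (χ i) (u b)) ξ) =
          -∑ a, ∫ ξ, (Real.fourierChar (inner ℝ ξ (r • w i)) : ℂ) *
            (freq s (F a) ξ * freqInv (-s) (smulCLM (-s) (χ i) (v a) +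
              ∑ b, smulCLM (-s) (dopS (c b a) (χ i)) (u b)) ξ) := by
      filter_upwards [hev] with r hr
      choose u' hu' hup using fun b => exists_translate (r • w i) (smulCLM (-s) (χ i) (u b))
      choose v' hv' hvp using fun a => exists_translate (r • w i) (smulCLM (-s) (χ i) (v a) +
        ∑ b, smulCLM (-s) (dopS (c b a) (χ i)) (u b))
      simp only [← hup, ← hvp]
      refine green_of_compact c F K u' v' hD hK (fun a => ?_)
        (hC.image (continuous_add_const (r • w i))) hr (fun b => ?_)
      · rw [hv']
        simp only [hu', dop_translate, map_sum, dist_smulCLM, dop_smul, map_add, hv,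
          Finset.sum_add_distrib]
      · rw [hu', dist_smulCLM]
        exact isVanishingOn_translate (isVanishingOn_smulLeftCLM_of_tsupport (hu b) (χ i)) _
    have h1 := (tendsto_finsetSum Finset.univ fun b _ =>
      tendsto_integral_fourierChar (w i) (K b) (smulCLM (-s) (χ i) (u b))).mono_left
        (nhdsWithin_le_nhds (s := Set.Ioi 0))
    have h2 := (tendsto_finsetSum Finset.univ fun a _ =>
      tendsto_integral_fourierChar (w i) (F a) (smulCLM (-s) (χ i) (v a) +
        ∑ b, smulCLM (-s) (dopS (c b a) (χ i)) (u b))).neg.mono_left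
        (nhdsWithin_le_nhds (s := Set.Ioi 0))
    exact tendsto_nhds_unique (h1.congr' hcongr) h2
  have hsum := Finset.sum_congr (rfl : (Finset.univ : Finset t) = Finset.univ) fun i _ => hloc i
  have hlin : ∀ (ψ : t → 𝓢(Cn n, ℂ)) (z : Sobolev n (-s)),
      ∑ i, smulCLM (-s) (ψ i) z = smulCLM (-s) (∑ i, ψ i) z := fun ψ z => dist_injective (by
    rw [map_sum]
    simp only [dist_smulCLM]
    ext φ
    rw [_root_.sum_apply]
    simp only [smulLeftCLM_apply_apply]
    rw [← map_sum]
    congr 1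
    ext x
    rw [_root_.sum_apply, SchwartzMap.smulLeftCLM_apply_apply (∑ i, ψ i).hasTemperateGrowth,
      _root_.sum_apply, Finset.sum_smul]
    exact Finset.sum_congr rfl fun i _ =>
      SchwartzMap.smulLeftCLM_apply_apply (ψ i).hasTemperateGrowth φ x)
  have hχ' : ∀ x ∈ closure D, ∀ᶠ y in 𝓝 x, (∑ i, χ i) y = 1 := by simpa using hχ
  -- Summed over `i`, the derivatives of the cutoffs cancel near `D̄`, since the cutoffs add up to
  -- `1` there.
  have hz : ∀ a, ∑ i, ∑ b, smulCLM (-s) (dopS (c b a) (χ i)) (u b) = 0 := fun a => by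
    rw [Finset.sum_comm]
    refine Finset.sum_eq_zero fun b _ => ?_
    rw [hlin, ← map_sum, smulCLM_dopS_eq_zero (hu b) hχ']
  rw [Finset.sum_neg_distrib] at hsum
  refine Eq.trans ?_ (hsum.trans (congrArg Neg.neg ?_)) <;> rw [Finset.sum_comm]
  · refine Finset.sum_congr rfl fun b _ => ?_
    rw [← map_sum, hlin, smulCLM_eq_self (hu b) hχ']
  · refine Finset.sum_congr rfl fun a _ => ?_
    rw [← map_sum, Finset.sum_add_distrib, hz, hlin, smulCLM_eq_self (hvD a) hχ', add_zero]

end Sobolev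

end SobolevDolbeault
end

noncomputable section
namespace SobolevDolbeault

open FourierTransform

variable {n p q p' q' : ℕ}

/-! ### Algebra of the `∂̄` complex -/

/-- The coefficients of `∂̄` as a first order system. -/
def dbarCoef (a : FormIdx n p (q + 1)) (b : FormIdx n p q) (j : Fin n) : ℂ :=
  if a.1.1 = b.1.1 ∧ j ∈ a.2.1 ∧ a.2.1.erase j = b.2.1 then
    (-1) ^ p * (-1) ^ (a.2.1.filter (fun k => k < j)).card
  else 0

theorem dbar_apply (u : Current n p q) (a : FormIdx n p (q + 1)) :
    dbar u a = ∑ b, dop (dbarCoef a b) (u b) := by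
  have h1 : dbar u a = ((-1 : ℂ) ^ p) • ∑ j : {j : Fin n // j ∈ a.2.1},
      ((-1 : ℂ) ^ (a.2.1.filter (fun k => k < j.1)).card) • dzbar j.1 (u (a.erase j)) := by
    simp [dbar]
  have h2 : ∀ j : Fin n, ∑ b, dbarCoef a b j • dzbar j (u b) =
      if h : j ∈ a.2.1 then ((-1 : ℂ) ^ p) •
        ((-1 : ℂ) ^ (a.2.1.filter (fun k => k < j)).card) • dzbar j (u (a.erase ⟨j, h⟩)) else 0 := by
    intro j
    split_ifs with h
    · rw [Finset.sum_eq_single (a.erase ⟨j, h⟩)]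
      · have : dbarCoef a (a.erase ⟨j, h⟩) j =
            (-1) ^ p * (-1) ^ (a.2.1.filter (fun k => k < j)).card := by
          rw [dbarCoef, if_pos ⟨rfl, h, rfl⟩]
        rw [this, smul_smul]
      · intro b _ hb
        have : dbarCoef a b j = 0 := by
          rw [dbarCoef, if_neg]
          rintro ⟨h1, -, h3⟩
          exact hb (Prod.ext (Subtype.ext h1.symm) (Subtype.ext h3.symm))
        rw [this]
        module
      · exact fun h => absurd (Finset.mem_univ _) h
    · refine Finset.sum_eq_zero fun b _ => ?_
      have : dbarCoef a b j = 0 := by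
        rw [dbarCoef, if_neg]
        exact fun h' => h h'.2.1
      rw [this]
      module
  simp only [dop, LinearMap.sum_apply, LinearMap.smul_apply]
  rw [Finset.sum_comm, h1, Finset.smul_sum]
  simp only [h2]
  rw [← Finset.sum_subset (Finset.subset_univ a.2.1) fun j _ hj => dif_neg hj]
  rw [← Finset.sum_coe_sort a.2.1]
  refine Finset.sum_congr rfl fun j _ => ?_
  rw [dif_pos j.2]

/-- Complementation of indices. -/
def complIdx (hp : p + p' = n) (hq : q + q' = n) : FormIdx n p q ≃ FormIdx n p' q' where
  toFun a := (⟨a.1.1ᶜ, by rw [Finset.card_compl, Fintype.card_fin, a.1.2]; omega⟩,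
    ⟨a.2.1ᶜ, by rw [Finset.card_compl, Fintype.card_fin, a.2.2]; omega⟩)
  invFun a := (⟨a.1.1ᶜ, by rw [Finset.card_compl, Fintype.card_fin, a.1.2]; omega⟩,
    ⟨a.2.1ᶜ, by rw [Finset.card_compl, Fintype.card_fin, a.2.2]; omega⟩)
  left_inv a := Prod.ext (Subtype.ext (compl_compl _)) (Subtype.ext (compl_compl _))
  right_inv a := Prod.ext (Subtype.ext (compl_compl _)) (Subtype.ext (compl_compl _))

/-- The factor with which the `(I,J)`-coefficient of `f` and the `(Iᶜ,Jᶜ)`-coefficient of `g`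
contribute to `∫ f ∧ g`. -/
def wedgeSign (p' : ℕ) (a : FormIdx n p q) : ℂ :=
  (-1) ^ (n * (n - 1) / 2) * (-2 * Complex.I) ^ n *
    ((-1) ^ (q * p') * shuffleSign a.1.1 * shuffleSign a.2.1)

theorem shuffleSign_ne_zero (I : Finset (Fin n)) : shuffleSign I ≠ 0 :=
  pow_ne_zero _ (by norm_num)

theorem wedgeSign_ne_zero (a : FormIdx n p q) : wedgeSign p' a ≠ 0 := by
  refine mul_ne_zero (mul_ne_zero (pow_ne_zero _ (by norm_num)) (pow_ne_zero _ (by simp))) ?_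
  exact mul_ne_zero (mul_ne_zero (pow_ne_zero _ (by norm_num)) (shuffleSign_ne_zero _))
    (shuffleSign_ne_zero _)

/-- Moving `j` from the complement into `J` adds the inversions of `j` with smaller elements of the
new complement and removes those of larger elements of `J` with `j`. Since `J.card` counts the
elements of `J` below `j` and above `j`, the parities agree. -/
theorem shuffleSign_insert {J : Finset (Fin n)} {j : Fin n} (hj : j ∉ J) :
    shuffleSign (insert j J) * (-1) ^ ((insert j J).filter (fun k => k < j)).card =
      (-1) ^ J.card * (shuffleSign J * (-1) ^ (Jᶜ.filter (fun k => k < j)).card) := by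
  have hinv : ∀ K : Finset (Fin n), ((K ×ˢ Kᶜ).filter (fun x => x.2 < x.1)).card =
      ∑ x ∈ K, (Kᶜ.filter (fun k => k < x)).card := fun K => by
    rw [Finset.card_filter, Finset.sum_product]
    exact Finset.sum_congr rfl fun x _ => (Finset.card_filter _ _).symm
  set C : Finset (Fin n) := (insert j J)ᶜ with hC
  have hjC : j ∉ C := by simp [hC]
  have hJC : Jᶜ = insert j C := by
    ext k
    simp only [hC, Finset.mem_compl, Finset.mem_insert]
    by_cases h : k = j
    · simp [h, hj]
    · simp [h]
  have h1 : ((insert j J).filter (fun k => k < j)).card = (J.filter (fun k => k < j)).card := by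
    rw [Finset.filter_insert, if_neg (lt_irrefl j)]
  have h2 : (Jᶜ.filter (fun k => k < j)).card = (C.filter (fun k => k < j)).card := by
    rw [hJC, Finset.filter_insert, if_neg (lt_irrefl j)]
  have h3 : ∀ x ∈ J, (Jᶜ.filter (fun k => k < x)).card =
      (C.filter (fun k => k < x)).card + if j < x then 1 else 0 := fun x _ => by
    rw [hJC, Finset.filter_insert]
    split_ifs with h
    · rw [Finset.card_insert_of_notMem (by simp [hjC])]
    · simp
  have h4 : J.card = (J.filter (fun k => k < j)).card + (J.filter (fun k => j < k)).card := by
    rw [← Finset.card_filter_add_card_filter_not (s := J) (fun k => k < j)]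
    congr 2
    refine Finset.filter_congr fun k hk => ?_
    have : k ≠ j := fun h => hj (h ▸ hk)
    rw [not_lt]
    exact ⟨fun h => lt_of_le_of_ne h this.symm, le_of_lt⟩
  rw [shuffleSign, shuffleSign, hinv, hinv, ← hC, Finset.sum_insert hj, Finset.sum_congr rfl h3,
    Finset.sum_add_distrib, ← Finset.card_filter, h1, h2, h4]
  rw [← pow_add, ← pow_add, ← pow_add]
  refine neg_one_pow_congr ?_
  simp only [Nat.even_add]
  tauto

/-- Removing `j` from `K` to get `J` is the same as removing `j` from `Jᶜ` to get `Kᶜ`, so both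
coefficients are nonzero together. The signs then match by `shuffleSign_insert`; the `(-1)^p'` from
moving one more `dz̄` is the one carried by `∂̄` on `(p',q')`-forms. -/
theorem wedgeSign_mul_dbarCoef (hp : p + p' = n) (hq : q + 1 + q' = n) (hq' : q + (q' + 1) = n)
    (a : FormIdx n p (q + 1)) (b : FormIdx n p q) (j : Fin n) :
    wedgeSign p' a * dbarCoef a b j = (-1) ^ (p + q) *
      (wedgeSign p' b * dbarCoef (complIdx hp hq' b) (complIdx hp hq a) j) := by
  have hcond : ((complIdx hp hq' b).1.1 = (complIdx hp hq a).1.1 ∧ j ∈ (complIdx hp hq' b).2.1 ∧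
      (complIdx hp hq' b).2.1.erase j = (complIdx hp hq a).2.1) ↔
      (a.1.1 = b.1.1 ∧ j ∈ a.2.1 ∧ a.2.1.erase j = b.2.1) := by
    change (b.1.1ᶜ = a.1.1ᶜ ∧ j ∈ b.2.1ᶜ ∧ b.2.1ᶜ.erase j = a.2.1ᶜ) ↔ _
    rw [compl_inj_iff, eq_comm, Finset.mem_compl]
    refine and_congr Iff.rfl ⟨fun ⟨h1, h2⟩ => ?_, fun ⟨h1, h2⟩ => ?_⟩
    · have h3 : a.2.1 = insert j b.2.1 := by
        rw [← compl_inj_iff, ← h2, Finset.compl_insert]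
      rw [h3]
      exact ⟨Finset.mem_insert_self _ _, Finset.erase_insert h1⟩
    · rw [← h2]
      refine ⟨Finset.notMem_erase _ _, ?_⟩
      rw [← Finset.compl_insert, Finset.insert_erase h1]
  by_cases h : a.1.1 = b.1.1 ∧ j ∈ a.2.1 ∧ a.2.1.erase j = b.2.1
  · rw [dbarCoef, if_pos h, dbarCoef, if_pos (hcond.mpr h)]
    obtain ⟨h1, h2, h3⟩ := h
    have hjb : j ∉ b.2.1 := by rw [← h3]; exact Finset.notMem_erase _ _
    have h4 : a.2.1 = insert j b.2.1 := by rw [← h3, Finset.insert_erase h2]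
    have h5 := shuffleSign_insert hjb
    rw [← h4, b.2.2] at h5
    change _ = (-1) ^ (p + q) * (wedgeSign p' b * ((-1) ^ p' *
      (-1) ^ (b.2.1ᶜ.filter (fun k => k < j)).card))
    simp only [wedgeSign, h1]
    have e1 : (-1 : ℂ) ^ ((q + 1) * p') = (-1) ^ (q * p') * (-1) ^ p' := by ring
    rw [e1, pow_add]
    linear_combination ((-1) ^ (n * (n - 1) / 2) * (-2 * Complex.I) ^ n * (-1) ^ (q * p') *
      (-1) ^ p' * shuffleSign b.1.1 * (-1) ^ p) * h5
  · rw [dbarCoef, if_neg h, dbarCoef, if_neg (mt hcond.mp h)]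
    simp

/-- The transpose of `∂̄` under the wedge pairing is `∂̄`, up to sign. -/
theorem sum_dop_dbarCoef_wedgeSign (hp : p + p' = n) (hq : q + 1 + q' = n)
    (hq' : q + (q' + 1) = n) (g : Current n p' q') (b : FormIdx n p q) :
    ∑ a : FormIdx n p (q + 1), dop (dbarCoef a b) (wedgeSign p' a • g (complIdx hp hq a)) =
      (-1 : ℂ) ^ (p + q) • wedgeSign p' b • dbar g (complIdx hp hq' b) := by
  rw [dbar_apply, ← (complIdx hp hq).sum_comp, Finset.smul_sum, Finset.smul_sum]
  refine Finset.sum_congr rfl fun a _ => ?_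
  simp only [dop, LinearMap.sum_apply, LinearMap.smul_apply, map_smul, Finset.smul_sum]
  refine Finset.sum_congr rfl fun j _ => ?_
  rw [smul_smul, smul_smul, smul_smul]
  refine congrArg (· • _) ?_
  linear_combination wedgeSign_mul_dbarCoef hp hq hq' a b j

theorem dzbar_comm (i j : Fin n) (u : 𝓢'(Cn n, ℂ)) : dzbar i (dzbar j u) = dzbar j (dzbar i u) := by
  have h : ∀ i : Fin n, (dzbar i : 𝓢'(Cn n, ℂ) →ₗ[ℂ] _) = dop (Pi.single i 1) := fun i => by
    rw [dop, Finset.sum_eq_single i]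
    · simp
    · intro k _ hk
      simp [hk]
    · exact fun h => absurd (Finset.mem_univ _) h
  have hinj : Function.Injective (𝓕 : 𝓢'(Cn n, ℂ) → 𝓢'(Cn n, ℂ)) :=
    Function.LeftInverse.injective fourierInv_fourier_eq
  refine hinj ?_
  rw [h, h, fourier_dop, fourier_dop, fourier_dop, fourier_dop,
    smulLeftCLM_smulLeftCLM_apply (by fun_prop) (by fun_prop),
    smulLeftCLM_smulLeftCLM_apply (by fun_prop) (by fun_prop), mul_comm]

theorem dbar_dbar (u : Current n p q) : dbar (dbar u) = 0 := by
  -- Coefficients are extended to functions of all finite sets, so that iterated erasures need no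
  -- cardinality proofs.
  have hext : ∀ {q : ℕ} (u : Current n p q) (I : {I : Finset (Fin n) // I.card = p}),
      ∃ U : Finset (Fin n) → 𝓢'(Cn n, ℂ), ∀ J (hJ : J.card = q), u (I, ⟨J, hJ⟩) = U J :=
    fun {q} u I => ⟨fun J => if h : J.card = q then u (I, ⟨J, h⟩) else 0, fun J hJ => by
      simp [hJ]⟩
  have hd : ∀ {q : ℕ} (u : Current n p q) (I : {I : Finset (Fin n) // I.card = p})
      (U : Finset (Fin n) → 𝓢'(Cn n, ℂ)), (∀ J (hJ : J.card = q), u (I, ⟨J, hJ⟩) = U J) →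
      ∀ K (hK : K.card = q + 1), dbar u (I, ⟨K, hK⟩) = ((-1 : ℂ) ^ p) •
        ∑ j ∈ K, ((-1 : ℂ) ^ (K.filter (fun k => k < j)).card) • dzbar j (U (K.erase j)) := by
    intro q u I U hU K hK
    rw [← Finset.sum_coe_sort K]
    simp only [dbar, LinearMap.pi_apply, LinearMap.smul_apply, LinearMap.sum_apply,
      LinearMap.comp_apply, LinearMap.proj_apply]
    congr 1
    refine Finset.sum_congr rfl fun j _ => ?_
    rw [← hU (K.erase j) (by rw [Finset.card_erase_of_mem j.2, hK]; rfl)]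
    rfl
  ext1 ⟨I, K, hK⟩
  obtain ⟨U, hU⟩ := hext u I
  obtain ⟨V, hV⟩ := hext (dbar u) I
  rw [hd (dbar u) I V hV K hK]
  have h1 : ∀ j ∈ K, V (K.erase j) = ((-1 : ℂ) ^ p) • ∑ i ∈ K.erase j,
      ((-1 : ℂ) ^ ((K.erase j).filter (fun k => k < i)).card) •
        dzbar i (U ((K.erase j).erase i)) := fun j hj => by
    have hc : (K.erase j).card = q + 1 := by rw [Finset.card_erase_of_mem hj, hK]; rfl
    rw [← hV _ hc, hd u I U hU _ hc]
  have h2 : ∑ j ∈ K, ((-1 : ℂ) ^ (K.filter (fun k => k < j)).card) • dzbar j (V (K.erase j)) =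
      ((-1 : ℂ) ^ p) • ∑ x ∈ K.sigma fun j => K.erase j,
        ((-1 : ℂ) ^ ((K.filter (fun k => k < x.1)).card +
          ((K.erase x.1).filter (fun k => k < x.2)).card)) •
          dzbar x.1 (dzbar x.2 (U ((K.erase x.1).erase x.2))) := by
    rw [Finset.sum_sigma, Finset.smul_sum]
    refine Finset.sum_congr rfl fun j hj => ?_
    rw [h1 j hj, map_smul, map_sum, smul_comm, Finset.smul_sum]
    congr 1
    refine Finset.sum_congr rfl fun i _ => ?_
    rw [map_smul, smul_smul, pow_add]
  -- Terms for `(j, i)` and `(i, j)` cancel: the derivatives commute, and removing the smaller index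
  -- first shifts the position of the larger by one.
  rw [h2, Finset.sum_involution (fun x _ => ⟨x.2, x.1⟩)]
  · simp
  · rintro ⟨j, i⟩ hx
    simp only [Finset.mem_sigma, Finset.mem_erase] at hx
    obtain ⟨hj, hij, hi⟩ := hx
    have key : ∀ i j : Fin n, i ∈ K → j ∈ K → i < j →
        (-1 : ℂ) ^ ((K.filter (fun k => k < j)).card + ((K.erase j).filter (fun k => k < i)).card) =
        -(-1 : ℂ) ^ ((K.filter (fun k => k < i)).card +
          ((K.erase i).filter (fun k => k < j)).card) := by
      intro i j hi hj hlt
      have e1 : ((K.erase j).filter (fun k => k < i)) = K.filter (fun k => k < i) := by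
        ext k
        simp only [Finset.mem_filter, Finset.mem_erase]
        exact ⟨fun h => ⟨h.1.2, h.2⟩, fun h => ⟨⟨(h.2.trans hlt).ne, h.1⟩, h.2⟩⟩
      have e2 : ((K.erase i).filter (fun k => k < j)) = (K.filter (fun k => k < j)).erase i := by
        rw [Finset.filter_erase]
      have e3 : (K.filter (fun k => k < j)).card =
          ((K.filter (fun k => k < j)).erase i).card + 1 :=
        (Finset.card_erase_add_one (by simp [hi, hlt])).symm
      rw [e1, e2, e3]
      ring
    dsimp only
    rw [dzbar_comm i j, Finset.erase_right_comm (a := i)]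
    rcases lt_or_gt_of_ne hij with h | h
    · rw [key i j hi hj h]
      module
    · rw [key j i hj hi h]
      module
  · rintro ⟨j, i⟩ hx _ heq
    simp only [Finset.mem_sigma, Finset.mem_erase] at hx
    simp only [Sigma.mk.injEq] at heq
    exact hx.2.1 heq.1
  · rintro ⟨j, i⟩ hx
    simp only [Finset.mem_sigma, Finset.mem_erase] at hx ⊢
    exact ⟨hx.2.2, hx.2.1.symm, hx.1⟩
  · rintro ⟨j, i⟩ _
    rfl

theorem vanishingOn_dbar {D : Set (Cn n)} {u : Current n p q} (hu : u ∈ vanishingOn n p q D) :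
    dbar u ∈ vanishingOn n p (q + 1) D := fun a => by
  rw [dbar_apply]
  exact isVanishingOn_sum _ fun b _ => isVanishingOn_dop (hu b)

end SobolevDolbeault
end

noncomputable section
namespace SobolevDolbeault

open Sobolev

variable {n p q p' q' : ℕ} {s : ℝ} {D : Set (Cn n)}

/-! ### The pairing of forms -/

theorem SobolevForm.current_apply (u : SobolevForm n s p q) (a : FormIdx n p q) :
    u.current a = (u a).dist := rfl

/-- Each condition `u(φ) = 0` is continuous on `W^s`. As an instance this makes the quotient
`W^s(D̄)` a normed and not only a semi-normed space. -/
instance isClosed_comap_vanishingOn (S : Set (Cn n)) :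
    IsClosed (((vanishingOn n p q S).comap SobolevForm.current :
      Submodule ℂ (SobolevForm n s p q)) : Set (SobolevForm n s p q)) := by
  have : (((vanishingOn n p q S).comap SobolevForm.current :
      Submodule ℂ (SobolevForm n s p q)) : Set (SobolevForm n s p q)) =
      ⋂ (a : FormIdx n p q) (φ : 𝓢(Cn n, ℂ)) (_ : tsupport φ ⊆ S), {u | (u a).dist φ = 0} := by
    ext u
    simp only [Set.mem_iInter]
    rfl
  rw [this]
  exact isClosed_iInter fun a => isClosed_iInter fun φ => isClosed_iInter fun _ =>
    isClosed_eq ((continuous_dist_apply φ).comp (PiLp.continuous_apply 2 _ a)) continuous_const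

instance : CompleteSpace (SobolevFormSupp n s D p q) :=
  (isClosed_comap_vanishingOn (closure D)ᶜ).completeSpace_coe

/-- The pairing of `(p,q)`-forms in `W^s` and `(n-p,n-q)`-forms in `W^{-s}` extending `∫ f ∧ g`. -/
def wedge (s : ℝ) (hp : p + p' = n) (hq : q + q' = n) :
    SobolevForm n s p q →L[ℂ] SobolevForm n (-s) p' q' →L[ℂ] ℂ :=
  ∑ a : FormIdx n p q, wedgeSign p' a • (pairing n s).bilinearComp
    (PiLp.proj 2 (fun _ : FormIdx n p q => Sobolev n s) a)
    (PiLp.proj 2 (fun _ : FormIdx n p' q' => Sobolev n (-s)) (complIdx hp hq a))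

theorem wedge_apply (hp : p + p' = n) (hq : q + q' = n) (f : SobolevForm n s p q)
    (g : SobolevForm n (-s) p' q') : wedge s hp hq f g =
      ∑ a, wedgeSign p' a * pairing n s (f a) (g (complIdx hp hq a)) := by
  simp [wedge, _root_.sum_apply]

theorem wedge_ofSchwartz_left (hp : p + p' = n) (hq : q + q' = n) (f : FormIdx n p q → 𝓢(Cn n, ℂ))
    (g : SobolevForm n (-s) p' q') : wedge s hp hq (SobolevForm.ofSchwartz s f) g =
      ∑ a, wedgeSign p' a * (g (complIdx hp hq a)).dist (f a) := by
  rw [wedge_apply]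
  exact Finset.sum_congr rfl fun a _ => congrArg _ (pairing_ofSchwartz_left (f a) _)

theorem wedge_ofSchwartz_right (hp : p + p' = n) (hq : q + q' = n) (f : SobolevForm n s p q)
    (g : FormIdx n p' q' → 𝓢(Cn n, ℂ)) : wedge s hp hq f (SobolevForm.ofSchwartz (-s) g) =
      ∑ a, wedgeSign p' a * (f a).dist (g (complIdx hp hq a)) := by
  rw [wedge_apply]
  exact Finset.sum_congr rfl fun a _ => congrArg _ (pairing_ofSchwartz_right (f a) _)

theorem wedge_single_left (hp : p + p' = n) (hq : q + q' = n) (a : FormIdx n p q)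
    (ψ : 𝓢(Cn n, ℂ)) (g : SobolevForm n (-s) p' q') :
    wedge s hp hq (SobolevForm.ofSchwartz s (Pi.single a ψ)) g =
      wedgeSign p' a * (g (complIdx hp hq a)).dist ψ := by
  rw [wedge_ofSchwartz_left, Finset.sum_eq_single a]
  · rw [Pi.single_eq_same]
  · intro b _ hb
    rw [Pi.single_eq_of_ne hb, map_zero, mul_zero]
  · exact fun h => absurd (Finset.mem_univ _) h

theorem wedge_single_right (hp : p + p' = n) (hq : q + q' = n) (a : FormIdx n p q)
    (ψ : 𝓢(Cn n, ℂ)) (f : SobolevForm n s p q) :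
    wedge s hp hq f (SobolevForm.ofSchwartz (-s) (Pi.single (complIdx hp hq a) ψ)) =
      wedgeSign p' a * (f a).dist ψ := by
  rw [wedge_ofSchwartz_right, Finset.sum_eq_single a]
  · rw [Pi.single_eq_same]
  · intro b _ hb
    rw [Pi.single_eq_of_ne ((complIdx hp hq).injective.ne hb), map_zero, mul_zero]
  · exact fun h => absurd (Finset.mem_univ _) h

theorem exists_piLp_coeffs {ι : Type} [Fintype ι] [DecidableEq ι] {E : Type}
    [NormedAddCommGroup E] [NormedSpace ℂ E] (φ : PiLp 2 (fun _ : ι => E) →L[ℂ] ℂ) :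
    ∃ ψ : ι → E →L[ℂ] ℂ, ∀ x, φ x = ∑ i, ψ i (x i) := by
  let e := PiLp.continuousLinearEquiv 2 ℂ (fun _ : ι => E)
  let φ' : (ι → E) →L[ℂ] ℂ := φ.comp e.symm.toContinuousLinearMap
  refine ⟨fun i => φ'.comp (ContinuousLinearMap.single ℂ (fun _ : ι => E) i), fun x => ?_⟩
  have h1 : φ x = φ' (e x) := congrArg φ (e.symm_apply_apply x).symm
  rw [h1, ← Finset.univ_sum_single (e x), map_sum]
  rfl

theorem wedge_represents (hp : p + p' = n) (hq : q + q' = n) : Represents (wedge s hp hq) where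
  left φ := by
    obtain ⟨ψ, hψ⟩ := exists_piLp_coeffs φ
    choose v hv using fun a => pairing_represents_left (ψ a)
    refine ⟨WithLp.toLp 2 fun b => (wedgeSign p' ((complIdx hp hq).symm b))⁻¹ •
      v ((complIdx hp hq).symm b), fun x => ?_⟩
    rw [hψ, wedge_apply]
    refine Finset.sum_congr rfl fun a _ => ?_
    change _ = _ * pairing n s (x a) ((wedgeSign p' ((complIdx hp hq).symm (complIdx hp hq a)))⁻¹ •
      v ((complIdx hp hq).symm (complIdx hp hq a)))
    rw [Equiv.symm_apply_apply, map_smul, smul_eq_mul,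
      mul_inv_cancel_left₀ (wedgeSign_ne_zero a), hv]
  right φ := by
    obtain ⟨ψ, hψ⟩ := exists_piLp_coeffs φ
    choose v hv using fun a => pairing_represents_right (s := s) (ψ a)
    refine ⟨WithLp.toLp 2 fun a => (wedgeSign p' a)⁻¹ • v (complIdx hp hq a), fun y => ?_⟩
    rw [hψ, wedge_apply, ← (complIdx hp hq).sum_comp]
    refine Finset.sum_congr rfl fun a _ => ?_
    change _ = _ * pairing n s ((wedgeSign p' a)⁻¹ • v (complIdx hp hq a)) _
    rw [map_smul, _root_.smul_apply, smul_eq_mul,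
      mul_inv_cancel_left₀ (wedgeSign_ne_zero a), hv]

theorem isVanishingOn_ofSchwartz {ψ : 𝓢(Cn n, ℂ)} {S T : Set (Cn n)} (hψ : tsupport ψ ⊆ T)
    (hST : Disjoint S T) : Distribution.IsVanishingOn (ofSchwartz s ψ).dist S := fun χ hχ => by
  rw [dist_ofSchwartz]
  refine integral_eq_zero_of_ae (Filter.Eventually.of_forall fun x => ?_)
  by_cases hx : x ∈ S
  · have : ψ x = 0 := image_eq_zero_of_notMem_tsupport fun h => hST.notMem_of_mem_left hx (hψ h)
    simp [this]
  · have : χ x = 0 := image_eq_zero_of_notMem_tsupport fun h => hx (hχ h)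
    simp [this]

theorem ofSchwartz_mem_vanishingOn {f : FormIdx n p q → 𝓢(Cn n, ℂ)} {S T : Set (Cn n)}
    (hf : ∀ a, tsupport (f a) ⊆ T) (hST : Disjoint S T) :
    SobolevForm.ofSchwartz s f ∈ (vanishingOn n p q S).comap SobolevForm.current :=
  fun a => isVanishingOn_ofSchwartz (s := s) (hf a) hST

theorem tsupport_single_subset {ι : Type} [DecidableEq ι] {ψ : 𝓢(Cn n, ℂ)} {T : Set (Cn n)}
    (hψ : tsupport ψ ⊆ T) (a b : ι) :
    tsupport ((Pi.single a ψ : ι → 𝓢(Cn n, ℂ)) b) ⊆ T := by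
  by_cases h : b = a
  · subst h
    rwa [Pi.single_eq_same]
  · rw [Pi.single_eq_of_ne h]
    simp [tsupport, Function.support]

/-- Green's formula for the empty system: a form that vanishes on `D` satisfies `K = 0` there. This
makes the pairing well defined on restrictions. -/
theorem wedge_eq_zero (hD : IsOpen D) (hb : Bornology.IsBounded D) (hL : HasLipschitzBoundary D)
    (hp : p + p' = n) (hq : q + q' = n) {f : SobolevForm n s p q} {g : SobolevForm n (-s) p' q'}
    (hf : f ∈ (vanishingOn n p q D).comap SobolevForm.current)
    (hg : g ∈ (vanishingOn n p' q' (closure D)ᶜ).comap SobolevForm.current) :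
    wedge s hp hq f g = 0 := by
  have h := green (A := Empty) (s := s) (fun (_ : FormIdx n p q) _ _ => 0) (fun a => a.elim)
    (fun b => f b) (fun b => wedgeSign p' b • g (complIdx hp hq b)) (fun a => a.elim) hD hb hL
    (fun b => by simpa [SobolevForm.current_apply] using hf b) (fun a => a.elim) (fun b φ hφ => by
      rw [map_smul, _root_.smul_apply]
      exact (congrArg _ (hg (complIdx hp hq b) φ hφ)).trans (smul_zero _))
  rw [wedge_apply]
  simpa using h

theorem restrict_eq_zero_iff {f : SobolevForm n s p q} :
    restrict D f = 0 ↔ f ∈ (vanishingOn n p q D).comap SobolevForm.current :=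
  Submodule.Quotient.mk_eq_zero _

theorem exists_domainPairing (s : ℝ) (hD : IsOpen D) (hb : Bornology.IsBounded D)
    (hL : HasLipschitzBoundary D) (hp : p + p' = n) (hq : q + q' = n) :
    ∃ P : SobolevFormOn n s D p q →L[ℂ] SobolevFormSupp n (-s) D p' q' →L[ℂ] ℂ,
      ∀ f g, P (restrict D f) g = wedge s hp hq f g := by
  obtain ⟨P, hP⟩ := exists_lift_of_isQuotientMap (G := SobolevFormSupp n (-s) D p' q' →L[ℂ] ℂ)
    (restrict D : SobolevForm n s p q →ₗ[ℂ] SobolevFormOn n s D p q)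
    (Submodule.isOpenQuotientMap_mkQ _).isQuotientMap
    ((wedge s hp hq).bilinearComp (ContinuousLinearMap.id ℂ _) (Submodule.subtypeL _))
    fun f hf => by
      ext g
      exact wedge_eq_zero hD hb hL hp hq (restrict_eq_zero_iff.mp hf) g.2
  exact ⟨P, fun f g => by rw [hP]; rfl⟩

/-- On the left, a functional on a quotient pulls back to one represented by some `v`, which kills
all Schwartz forms supported off `D̄` and is therefore supported in `D̄`. On the right, a functional
on a subspace extends by Hahn–Banach. -/
theorem domainPairing_represents {hp : p + p' = n} {hq : q + q' = n}
    {P : SobolevFormOn n s D p q →L[ℂ] SobolevFormSupp n (-s) D p' q' →L[ℂ] ℂ}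
    (hP : ∀ f g, P (restrict D f) g = wedge s hp hq f g) : Represents P where
  left φ := by
    obtain ⟨v, hv⟩ := (wedge_represents hp hq).left
      (φ.comp (Submodule.mkQL ((vanishingOn n p q D).comap SobolevForm.current)))
    have hv' : ∀ f, φ (restrict D f) = wedge s hp hq f v := hv
    have hmem : v ∈ (vanishingOn n p' q' (closure D)ᶜ).comap SobolevForm.current := fun b ψ hψ => by
      obtain ⟨a, rfl⟩ := (complIdx hp hq).surjective b
      have h1 := hv' (SobolevForm.ofSchwartz s (Pi.single a ψ))
      rw [wedge_single_left, restrict_eq_zero_iff.mpr (ofSchwartz_mem_vanishingOn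
        (fun b => tsupport_single_subset hψ a b)
        (Set.disjoint_compl_right_iff_subset.mpr subset_closure)), map_zero, eq_comm] at h1
      exact (mul_eq_zero.mp h1).resolve_left (wedgeSign_ne_zero a)
    refine ⟨⟨v, hmem⟩, fun x => ?_⟩
    obtain ⟨f, rfl⟩ := Submodule.mkQ_surjective _ x
    exact (hv' f).trans (hP f ⟨v, hmem⟩).symm
  right ψ := by
    obtain ⟨Ψ, hΨ, -⟩ := exists_extension_norm_eq _ ψ
    obtain ⟨f, hf⟩ := (wedge_represents hp hq).right Ψ
    exact ⟨restrict D f, fun y => by rw [hP, ← hf, hΨ]⟩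

end SobolevDolbeault
end

noncomputable section
namespace SobolevDolbeault

open Sobolev

variable {n p q p' q' : ℕ} {s : ℝ} {D : Set (Cn n)}

/-! ### Duality of the maximal and minimal realizations -/

/-- The graph only asks for some pair of extensions; because `∂̄` is local, changing them alters
`∂̄f - k` by a current vanishing on `D`. -/
theorem restrict_mem_maxGraph {f : SobolevForm n s p q} {k : SobolevForm n s p (q + 1)} :
    (restrict D f, restrict D k) ∈ maxGraph n s D p q ↔
      dbar f.current - k.current ∈ vanishingOn n p (q + 1) D := by
  constructor
  · rintro ⟨⟨f', k'⟩, h, heq⟩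
    obtain ⟨h1, h2⟩ := Prod.ext_iff.mp heq
    have h3 : f - f' ∈ (vanishingOn n p q D).comap SobolevForm.current := by
      rw [← restrict_eq_zero_iff, map_sub, sub_eq_zero]
      exact h1.symm
    have h4 : k - k' ∈ (vanishingOn n p (q + 1) D).comap SobolevForm.current := by
      rw [← restrict_eq_zero_iff, map_sub, sub_eq_zero]
      exact h2.symm
    have h5 : dbar f'.current - k'.current ∈ vanishingOn n p (q + 1) D := h
    have h6 := Submodule.sub_mem _ (Submodule.add_mem _ h5 (vanishingOn_dbar h3)) h4
    convert h6 using 1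
    rw [map_sub, map_sub, map_sub]
    abel
  · exact fun h => ⟨(f, k), h, rfl⟩

theorem mem_minGraph {g : SobolevFormSupp n s D p q} {h : SobolevFormSupp n s D p (q + 1)} :
    (g, h) ∈ minGraph n s D p q ↔ dbar (SobolevForm.current (g : SobolevForm n s p q)) =
      SobolevForm.current (h : SobolevForm n s p (q + 1)) :=
  sub_eq_zero

theorem dop_ofSchwartz (c : Fin n → ℂ) (φ : 𝓢(Cn n, ℂ)) :
    dop c (ofSchwartz s φ).dist = (ofSchwartz s (dopS c φ)).dist := by
  change dop c (SchwartzMap.toTemperedDistributionCLM (Cn n) ℂ volume φ) =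
    SchwartzMap.toTemperedDistributionCLM (Cn n) ℂ volume (dopS c φ)
  simp only [dop, dopS, dzbar, LinearMap.sum_apply, LinearMap.smul_apply, LinearMap.add_apply,
    ContinuousLinearMap.coe_coe, LineDeriv.lineDerivOpCLM_apply, map_sum, map_smul, map_add,
    lineDerivOp_toTemperedDistributionCLM_eq]

theorem dbar_single (a : FormIdx n p q) (ψ : 𝓢(Cn n, ℂ)) :
    dbar (SobolevForm.ofSchwartz s (Pi.single a ψ)).current =
      (SobolevForm.ofSchwartz s (fun b => dopS (dbarCoef b a) ψ)).current := by
  ext1 b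
  rw [dbar_apply, Finset.sum_eq_single a]
  · change dop _ (ofSchwartz s ((Pi.single a ψ : FormIdx n p q → 𝓢(Cn n, ℂ)) a)).dist = _
    rw [Pi.single_eq_same, dop_ofSchwartz]
    rfl
  · intro c _ hc
    change dop _ (ofSchwartz s ((Pi.single a ψ : FormIdx n p q → 𝓢(Cn n, ℂ)) c)).dist = _
    rw [Pi.single_eq_of_ne hc, ← ofSchwartzₗ_apply, map_zero, map_zero, map_zero]
  · exact fun h => absurd (Finset.mem_univ _) h

theorem wedge_dbar (hD : IsOpen D) (hb : Bornology.IsBounded D) (hL : HasLipschitzBoundary D)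
    (hp : p + p' = n) (hq : q + 1 + q' = n) (hq' : q + (q' + 1) = n)
    {f : SobolevForm n s p q} {k : SobolevForm n s p (q + 1)}
    (hfk : dbar f.current - k.current ∈ vanishingOn n p (q + 1) D)
    {g : SobolevForm n (-s) p' q'} {h : SobolevForm n (-s) p' (q' + 1)}
    (hg : g ∈ (vanishingOn n p' q' (closure D)ᶜ).comap SobolevForm.current)
    (hgh : dbar g.current = h.current) :
    wedge s hp hq k g = -(-1) ^ (p + q) * wedge s hp hq' f h := by
  have key := green (s := s) (fun (b : FormIdx n p (q + 1)) (a : FormIdx n p q) => dbarCoef b a)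
    (fun a => f a) (fun b => k b) (fun b => wedgeSign p' b • g (complIdx hp hq b))
    (fun a => (-1 : ℂ) ^ (p + q) • wedgeSign p' a • h (complIdx hp hq' a)) hD hb hL
    (fun b => by
      have h1 := (Submodule.neg_mem _ hfk) b
      rw [neg_sub] at h1
      convert h1 using 2
      rw [Pi.sub_apply, dbar_apply]
      rfl)
    (fun a => by
      have h1 := sum_dop_dbarCoef_wedgeSign hp hq hq' g.current a
      rw [hgh] at h1
      simp only [map_smul]
      simp only [map_smul] at h1
      exact h1.symm)
    (fun b φ hφ => by
      rw [map_smul, _root_.smul_apply]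
      exact (congrArg _ (hg (complIdx hp hq b) φ hφ)).trans (smul_zero _))
  simp only [map_smul, smul_eq_mul, ← Finset.mul_sum] at key
  rw [wedge_apply, wedge_apply, key, neg_mul]

theorem mul_dop_eq {c c' : Fin n → ℂ} {r t : ℂ} (h : ∀ j, r * c j = t * c' j) (u : 𝓢'(Cn n, ℂ))
    (ψ : 𝓢(Cn n, ℂ)) : r * u (dopS c ψ) = t * u (dopS c' ψ) := by
  have h1 : r • dop c u = t • dop c' u := by
    simp only [dop, LinearMap.sum_apply, LinearMap.smul_apply, Finset.smul_sum, smul_smul, h]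
  have h2 := congrArg (fun v : 𝓢'(Cn n, ℂ) => v ψ) h1
  simp only [_root_.smul_apply, dop_apply_apply, smul_eq_mul, mul_neg, neg_inj] at h2
  exact h2

section Adjoint

variable (hD : IsOpen D) (hb : Bornology.IsBounded D) (hL : HasLipschitzBoundary D)
  (hp : p + p' = n) (hq : q + 1 + q' = n) (hq' : q + (q' + 1) = n)
  {P₁ : SobolevFormOn n s D p (q + 1) →L[ℂ] SobolevFormSupp n (-s) D p' q' →L[ℂ] ℂ}
  {P : SobolevFormOn n s D p q →L[ℂ] SobolevFormSupp n (-s) D p' (q' + 1) →L[ℂ] ℂ}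
  (hP₁ : ∀ f g, P₁ (restrict D f) g = wedge s hp hq f g)
  (hP : ∀ f g, P (restrict D f) g = wedge s hp hq' f g)

include hD hb hL hP₁ hP

/-- One direction is Green's formula. For the other, test forms with a single coefficient `ψ`
supported in `D`, paired with their `∂̄`, belong to the minimal graph and read off each coefficient
of `∂̄f - k` on `D`. -/
theorem mem_maxGraph_iff (x : SobolevFormOn n s D p q) (y : SobolevFormOn n s D p (q + 1)) :
    (x, y) ∈ maxGraph n s D p q ↔
      ∀ g h, (g, h) ∈ minGraph n (-s) D p' q' → P₁ y g = -(-1) ^ (p + q) * P x h := by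
  obtain ⟨f, rfl⟩ := Submodule.mkQ_surjective _ x
  obtain ⟨k, rfl⟩ := Submodule.mkQ_surjective _ y
  rw [restrict_mem_maxGraph]
  refine ⟨fun hfk g h hgh => ?_, fun H a ψ hψ => ?_⟩
  · rw [hP₁, hP]
    exact wedge_dbar hD hb hL hp hq hq' hfk g.2 (mem_minGraph.mp hgh)
  have hdisj : Disjoint (closure D)ᶜ D :=
    Set.disjoint_compl_left_iff_subset.mpr subset_closure
  have h1 := H ⟨SobolevForm.ofSchwartz (-s) (Pi.single (complIdx hp hq a) ψ),
      ofSchwartz_mem_vanishingOn (fun b => tsupport_single_subset hψ _ b) hdisj⟩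
    ⟨SobolevForm.ofSchwartz (-s) (fun b => dopS (dbarCoef b (complIdx hp hq a)) ψ),
      ofSchwartz_mem_vanishingOn (fun b => (tsupport_dopS_subset _ _).trans hψ) hdisj⟩
    (mem_minGraph.mpr (dbar_single _ _))
  rw [hP₁, hP, wedge_single_right, wedge_ofSchwartz_right] at h1
  have h2 : ∀ b : FormIdx n p q, wedgeSign p' b *
      (f b).dist (dopS (dbarCoef (complIdx hp hq' b) (complIdx hp hq a)) ψ) =
      (-1) ^ (p + q) * wedgeSign p' a * (f b).dist (dopS (dbarCoef a b) ψ) := fun b => by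
    refine mul_dop_eq (fun j => ?_) _ ψ
    have h3 := wedgeSign_mul_dbarCoef hp hq hq' a b j
    have h4 : (-1 : ℂ) ^ (p + q) * (-1) ^ (p + q) = 1 := by rw [← mul_pow]; norm_num
    linear_combination (-(-1) ^ (p + q)) * h3 -
      wedgeSign p' b * dbarCoef (complIdx hp hq' b) (complIdx hp hq a) j * h4
  rw [Finset.sum_congr rfl fun b _ => h2 b, ← Finset.mul_sum] at h1
  have h5 : (dbar f.current - k.current) a ψ =
      -∑ b, (f b).dist (dopS (dbarCoef a b) ψ) - (k a).dist ψ := by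
    rw [Pi.sub_apply, _root_.sub_apply, dbar_apply, _root_.sum_apply]
    simp only [dop_apply_apply, Finset.sum_neg_distrib]
    rfl
  rw [h5]
  have h4 : (-1 : ℂ) ^ (p + q) * (-1) ^ (p + q) = 1 := by rw [← mul_pow]; norm_num
  refine (mul_eq_zero.mp ?_).resolve_left (wedgeSign_ne_zero (p' := p') a)
  linear_combination -h1 + wedgeSign p' a * (∑ b, (f b).dist (dopS (dbarCoef a b) ψ)) * h4

/-- Here the test forms come from the maximal graph, where no support condition is imposed on `ψ`;
hence the equation results on all of `ℂⁿ` and not only inside `D`. -/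
theorem mem_minGraph_iff (g : SobolevFormSupp n (-s) D p' q')
    (h : SobolevFormSupp n (-s) D p' (q' + 1)) :
    (g, h) ∈ minGraph n (-s) D p' q' ↔
      ∀ x y, (x, y) ∈ maxGraph n s D p q → P₁ y g = -(-1) ^ (p + q) * P x h := by
  refine ⟨fun hgh x y hxy => (mem_maxGraph_iff hD hb hL hp hq hq' hP₁ hP x y).mp hxy g h hgh,
    fun H => mem_minGraph.mpr ?_⟩
  ext1 b
  obtain ⟨a, rfl⟩ := (complIdx hp hq').surjective b
  ext ψ
  have h1 := H (restrict D (SobolevForm.ofSchwartz s (Pi.single a ψ)))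
    (restrict D (SobolevForm.ofSchwartz s (fun b => dopS (dbarCoef b a) ψ)))
    (restrict_mem_maxGraph.mpr (by rw [dbar_single, sub_self]; exact Submodule.zero_mem _))
  rw [hP₁, hP, wedge_single_left, wedge_ofSchwartz_left] at h1
  have h2 := congrArg (fun v : 𝓢'(Cn n, ℂ) => v ψ)
    (sum_dop_dbarCoef_wedgeSign hp hq hq' (SobolevForm.current (g : SobolevForm n (-s) p' q')) a)
  simp only [_root_.sum_apply, _root_.smul_apply, dop_apply_apply, smul_eq_mul,
    Finset.sum_neg_distrib, SobolevForm.current_apply] at h2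
  rw [h1] at h2
  have h3 : (-1 : ℂ) ^ (p + q) * wedgeSign p' a ≠ 0 :=
    mul_ne_zero (pow_ne_zero _ (by norm_num)) (wedgeSign_ne_zero a)
  refine mul_left_cancel₀ h3 ?_
  rw [SobolevForm.current_apply]
  linear_combination -h2

end Adjoint

theorem coboundaries_le_cocycles_max :
    coboundaries (maxGraph n s D p) q ≤ cocycles (maxGraph n s D p) q := by
  cases q with
  | zero => exact bot_le
  | succ q =>
    rintro _ ⟨⟨x, y⟩, hxy, rfl⟩
    obtain ⟨f, rfl⟩ := Submodule.mkQ_surjective _ x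
    obtain ⟨k, rfl⟩ := Submodule.mkQ_surjective _ y
    have h1 := vanishingOn_dbar (restrict_mem_maxGraph.mp hxy)
    have h2 : (restrict D k, restrict D (0 : SobolevForm n s p (q + 1 + 1))) ∈
        maxGraph n s D p (q + 1) := by
      rw [restrict_mem_maxGraph]
      rw [map_sub, dbar_dbar, zero_sub, Submodule.neg_mem_iff] at h1
      rwa [map_zero, sub_zero]
    rw [map_zero] at h2
    exact h2

theorem coboundaries_le_cocycles_min :
    coboundaries (minGraph n s D p) q ≤ cocycles (minGraph n s D p) q := by
  cases q with
  | zero => exact bot_le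
  | succ q =>
    rintro _ ⟨⟨g, h⟩, hgh, rfl⟩
    refine mem_minGraph.mpr ?_
    change dbar (SobolevForm.current (h : SobolevForm n s p (q + 1))) = SobolevForm.current 0
    rw [← mem_minGraph.mp hgh, dbar_dbar, map_zero]

theorem isEmpty_formIdx (h : n < q) : IsEmpty (FormIdx n p q) :=
  ⟨fun a => by
    have := Finset.card_le_univ a.2.1
    rw [Fintype.card_fin, a.2.2] at this
    omega⟩

/-! ### Cocycles as annihilators of coboundaries -/

section Annihilators

variable (hD : IsOpen D) (hb : Bornology.IsBounded D) (hL : HasLipschitzBoundary D)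
  (hp : p + p' = n) (hq : q + q' = n)
  {P : SobolevFormOn n s D p q →L[ℂ] SobolevFormSupp n (-s) D p' q' →L[ℂ] ℂ}
  (hP : ∀ f g, P (restrict D f) g = wedge s hp hq f g)

include hD hb hL hP

theorem mem_Zmax_iff (x : SobolevFormOn n s D p q) : x ∈ Zmax n s D p q ↔
    ∀ y ∈ coboundaries (minGraph n (-s) D p') q', P x y = 0 := by
  cases q' with
  | zero =>
    -- Here `q = n`: there are no forms of degree `q + 1`, so every form is a cocycle, matching the
    -- convention that coboundaries in degree `0` are zero.
    refine ⟨fun _ y hy => by rw [(Submodule.mem_bot ℂ).mp hy, map_zero], fun _ => ?_⟩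
    obtain ⟨f, rfl⟩ := Submodule.mkQ_surjective _ x
    have : IsEmpty (FormIdx n p (q + 1)) := isEmpty_formIdx (by omega)
    have h2 : (restrict D f, restrict D (0 : SobolevForm n s p (q + 1))) ∈ maxGraph n s D p q :=
      restrict_mem_maxGraph.mpr fun a => isEmptyElim a
    rw [map_zero] at h2
    exact h2
  | succ q' =>
    obtain ⟨P₁, hP₁⟩ := exists_domainPairing s hD hb hL hp (show q + 1 + q' = n by omega)
    -- A cocycle is an `x` with `(x, 0)` in the graph; in the adjoint relation this leaves `P x h =
    -- 0` for all `h` in the range of the minimal realization.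
    refine (mem_maxGraph_iff hD hb hL hp _ hq hP₁ hP x 0).trans ⟨?_, fun H g h hgh => ?_⟩
    · rintro H _ ⟨⟨g, h⟩, hgh, rfl⟩
      have h1 := H g h hgh
      rw [map_zero, _root_.zero_apply, eq_comm] at h1
      exact (mul_eq_zero.mp h1).resolve_left (neg_ne_zero.mpr (pow_ne_zero _ (by norm_num)))
    · rw [H h ⟨(g, h), hgh, rfl⟩, map_zero, _root_.zero_apply, mul_zero]

theorem mem_Zmin_iff (y : SobolevFormSupp n (-s) D p' q') : y ∈ Zmin n (-s) D p' q' ↔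
    ∀ x ∈ coboundaries (maxGraph n s D p) q, P x y = 0 := by
  cases q with
  | zero =>
    refine ⟨fun _ x hx => by
      rw [(Submodule.mem_bot ℂ).mp hx, map_zero, _root_.zero_apply], fun _ => ?_⟩
    have : IsEmpty (FormIdx n p' (q' + 1)) := isEmpty_formIdx (by omega)
    exact mem_minGraph.mpr (Subsingleton.elim _ _)
  | succ q =>
    obtain ⟨P₀, hP₀⟩ := exists_domainPairing s hD hb hL hp (show q + (q' + 1) = n by omega)
    refine (mem_minGraph_iff hD hb hL hp hq _ hP hP₀ y 0).trans ⟨?_, fun H x z hxz => ?_⟩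
    · rintro H _ ⟨⟨x, z⟩, hxz, rfl⟩
      have h1 := H x z hxz
      rwa [map_zero, mul_zero] at h1
    · rw [H z ⟨(x, z), hxz, rfl⟩, map_zero, mul_zero]

theorem isClosed_Zmax : IsClosed (Zmax n s D p q : Set (SobolevFormOn n s D p q)) := by
  have : (Zmax n s D p q : Set (SobolevFormOn n s D p q)) =
      ⋂ y ∈ coboundaries (minGraph n (-s) D p') q', {x | P x y = 0} := by
    ext x
    simp only [SetLike.mem_coe, mem_Zmax_iff hD hb hL hp hq hP, Set.mem_iInter, Set.mem_ofPred_eq]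
  rw [this]
  exact isClosed_biInter fun y _ => isClosed_eq (P.flip y).continuous continuous_const

theorem isClosed_Zmin : IsClosed (Zmin n (-s) D p' q' : Set (SobolevFormSupp n (-s) D p' q')) := by
  have : (Zmin n (-s) D p' q' : Set (SobolevFormSupp n (-s) D p' q')) =
      ⋂ x ∈ coboundaries (maxGraph n s D p) q, {y | P x y = 0} := by
    ext y
    simp only [SetLike.mem_coe, mem_Zmin_iff hD hb hL hp hq hP, Set.mem_iInter, Set.mem_ofPred_eq]
  rw [this]
  exact isClosed_biInter fun x _ => isClosed_eq (P x).continuous continuous_const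

end Annihilators

end SobolevDolbeault
end

noncomputable section
namespace SobolevDolbeault

open Sobolev

variable {n p q p' q' : ℕ} {s : ℝ} {D : Set (Cn n)}

/-! ### Duality of the cohomology spaces -/

theorem domainPairing_extendsIntegralWedge (hp : p + (n - p) = n) (hq : q + (n - q) = n)
    {P : SobolevFormOn n s D p q →L[ℂ] SobolevFormSupp n (-s) D (n - p) (n - q) →L[ℂ] ℂ}
    (hP : ∀ f g, P (restrict D f) g = wedge s hp hq f g) : ExtendsIntegralWedge P := by
  intro f g hg G hG
  rw [hP, hG, wedge_ofSchwartz_right, integralWedge, Finset.mul_sum]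
  refine Finset.sum_congr rfl fun a _ => ?_
  have h1 : ∫ z in D, f a z * g a.compl z = (ofSchwartz s (f a)).dist (g a.compl) := by
    rw [dist_ofSchwartz, setIntegral_eq_integral_of_forall_compl_eq_zero fun z hz => ?_]
    · exact integral_congr_ae (Filter.Eventually.of_forall fun z => mul_comm _ _)
    · rw [image_eq_zero_of_notMem_tsupport fun h => hz (hg _ h), mul_zero]
  rw [h1, wedgeSign, mul_assoc]
  rfl

theorem SobolevForm.denseRange_ofSchwartz :
    DenseRange (SobolevForm.ofSchwartz s : (FormIdx n p q → 𝓢(Cn n, ℂ)) → SobolevForm n s p q) := by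
  have h1 : DenseRange (Pi.map fun _ : FormIdx n p q => ofSchwartzₗ n s) :=
    DenseRange.piMap fun _ => Sobolev.denseRange_ofSchwartz
  let e := PiLp.continuousLinearEquiv 2 ℂ (fun _ : FormIdx n p q => Sobolev n s)
  exact e.symm.surjective.denseRange.comp h1 e.symm.continuous

/-- For a fixed Schwartz form `f` the difference of the two pairings is a functional on
`W^{-s}_0(D̄)`, represented by some `w`. It kills forms supported in `D`, so `w` vanishes on `D` and
is zero in `W^s(D̄)`: this replaces a direct proof that such forms are dense. Density of Schwartz
forms handles the first factor. -/
theorem ExtendsIntegralWedge.eq (hp : p + (n - p) = n) (hq : q + (n - q) = n)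
    {P P' : SobolevFormOn n s D p q →L[ℂ] SobolevFormSupp n (-s) D (n - p) (n - q) →L[ℂ] ℂ}
    (hP : ∀ f g, P (restrict D f) g = wedge s hp hq f g) (hP' : ExtendsIntegralWedge P') :
    P' = P := by
  have key : ∀ f : FormIdx n p q → 𝓢(Cn n, ℂ), P' (restrict D (SobolevForm.ofSchwartz s f)) =
      P (restrict D (SobolevForm.ofSchwartz s f)) := by
    intro f
    obtain ⟨x, hx⟩ := (domainPairing_represents hP).right
      (P' (restrict D (SobolevForm.ofSchwartz s f)) - P (restrict D (SobolevForm.ofSchwartz s f)))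
    obtain ⟨w, rfl⟩ := Submodule.mkQ_surjective _ x
    have hw : restrict D w = 0 := by
      refine restrict_eq_zero_iff.mpr fun a ψ hψ => ?_
      have hsupp : ∀ b, tsupport ((Pi.single (complIdx hp hq a) ψ :
          FormIdx n (n - p) (n - q) → 𝓢(Cn n, ℂ)) b) ⊆ D :=
        fun b => tsupport_single_subset hψ _ b
      let G : SobolevFormSupp n (-s) D (n - p) (n - q) :=
        ⟨SobolevForm.ofSchwartz (-s) (Pi.single (complIdx hp hq a) ψ),
          ofSchwartz_mem_vanishingOn hsupp (Set.disjoint_compl_left_iff_subset.mpr subset_closure)⟩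
      have h1 := hx G
      rw [_root_.sub_apply, hP' f _ hsupp G rfl,
        domainPairing_extendsIntegralWedge hp hq hP f _ hsupp G rfl, sub_self, hP,
        wedge_single_right, eq_comm] at h1
      exact (mul_eq_zero.mp h1).resolve_left (wedgeSign_ne_zero a)
    rw [← sub_eq_zero]
    ext g
    rw [hx, hw, map_zero]
  ext1 x
  obtain ⟨u, rfl⟩ := Submodule.mkQ_surjective _ x
  have h2 := SobolevForm.denseRange_ofSchwartz.equalizer
    (P'.comp (Submodule.mkQL ((vanishingOn n p q D).comap SobolevForm.current))).continuous
    (P.comp (Submodule.mkQL ((vanishingOn n p q D).comap SobolevForm.current))).continuous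
    (funext key)
  exact congrFun h2 u

theorem t2Space_Hmax_iff (hD : IsOpen D) (hb : Bornology.IsBounded D) (hL : HasLipschitzBoundary D)
    (hp : p + p' = n) (hq : q + q' = n) :
    T2Space (Hmax n s D p q) ↔ T2Space (Hmin n (-s) D p' (q' + 1)) := by
  obtain ⟨P₁, hP₁⟩ := exists_domainPairing s hD hb hL hp hq
  have h1 : T2Space (Hmax n s D p q) ↔
      IsClosed (coboundaries (maxGraph n s D p) q : Set (SobolevFormOn n s D p q)) :=
    t2Space_quotient_iff coboundaries_le_cocycles_max (isClosed_Zmax hD hb hL hp hq hP₁)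
  rw [h1]
  cases q with
  | zero =>
    -- Here `q' = n`: the compactly supported cohomology in degree `n + 1` is zero, and the zero
    -- space of coboundaries in degree `0` is closed, so both sides hold.
    have : IsEmpty (FormIdx n p' (q' + 1)) := isEmpty_formIdx (by omega)
    have h2 : Subsingleton (Hmin n (-s) D p' (q' + 1)) :=
      (Submodule.mkQ_surjective ((coboundaries (minGraph n (-s) D p') (q' + 1)).submoduleOf
        (cocycles (minGraph n (-s) D p') (q' + 1)))).subsingleton
    exact ⟨fun _ => inferInstance, fun _ => isClosed_singleton⟩
  | succ q =>
    obtain ⟨P, hP⟩ := exists_domainPairing s hD hb hL hp (show q + (q' + 1) = n by omega)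
    have h2 : T2Space (Hmin n (-s) D p' (q' + 1)) ↔
        IsClosed (coboundaries (minGraph n (-s) D p') (q' + 1) :
          Set (SobolevFormSupp n (-s) D p' (q' + 1))) :=
      t2Space_quotient_iff coboundaries_le_cocycles_min (isClosed_Zmin hD hb hL hp _ hP)
    rw [h2]
    exact isClosed_range_iff (domainPairing_represents hP) (domainPairing_represents hP₁)
      (neg_ne_zero.mpr (pow_ne_zero (p + q) (by norm_num))) (maxGraph n s D p q)
      (minGraph n (-s) D p' q') (mem_minGraph_iff hD hb hL hp hq _ hP₁ hP)
      (mem_maxGraph_iff hD hb hL hp hq _ hP₁ hP)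

end SobolevDolbeault
end

theorem proposition4p2 (n : ℕ) (D : Set (SobolevDolbeault.Cn n)) (hD_open : IsOpen D)
    (hD_bdd : Bornology.IsBounded D) (hD_lip : SobolevDolbeault.HasLipschitzBoundary D)
    (p q : ℕ) (hp : p ≤ n) (hq : q ≤ n) (s : ℤ) :
    (T2Space (SobolevDolbeault.Hmax n (s : ℝ) D p q) ↔
      T2Space (SobolevDolbeault.Hmin n (-(s : ℝ)) D (n - p) (n - q + 1))) ∧
    CompleteSpace (SobolevDolbeault.RedHmax n (s : ℝ) D p q) ∧
    CompleteSpace (SobolevDolbeault.RedHmin n (-(s : ℝ)) D (n - p) (n - q)) ∧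
    ∃ B : SobolevDolbeault.SobolevFormOn n (s : ℝ) D p q →L[ℂ]
        SobolevDolbeault.SobolevFormSupp n (-(s : ℝ)) D (n - p) (n - q) →L[ℂ] ℂ,
      SobolevDolbeault.ExtendsIntegralWedge B ∧
      (∀ B' : SobolevDolbeault.SobolevFormOn n (s : ℝ) D p q →L[ℂ]
          SobolevDolbeault.SobolevFormSupp n (-(s : ℝ)) D (n - p) (n - q) →L[ℂ] ℂ,
        SobolevDolbeault.ExtendsIntegralWedge B' → B' = B) ∧
      ∃ β : SobolevDolbeault.RedHmax n (s : ℝ) D p q →L[ℂ]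
          SobolevDolbeault.RedHmin n (-(s : ℝ)) D (n - p) (n - q) →L[ℂ] ℂ,
        (∀ (f : SobolevDolbeault.Zmax n (s : ℝ) D p q)
            (g : SobolevDolbeault.Zmin n (-(s : ℝ)) D (n - p) (n - q)),
          β (SobolevDolbeault.redClass _ f) (SobolevDolbeault.redClass _ g) =
            B (f : SobolevDolbeault.SobolevFormOn n (s : ℝ) D p q)
              (g : SobolevDolbeault.SobolevFormSupp n (-(s : ℝ)) D (n - p) (n - q))) ∧
        SobolevDolbeault.IsPerfect (SobolevDolbeault.RedHmax n (s : ℝ) D p q)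
          (SobolevDolbeault.RedHmin n (-(s : ℝ)) D (n - p) (n - q)) β := by
  have hp' : p + (n - p) = n := Nat.add_sub_cancel' hp
  have hq' : q + (n - q) = n := Nat.add_sub_cancel' hq
  obtain ⟨P, hP⟩ :=
    SobolevDolbeault.exists_domainPairing (s : ℝ) hD_open hD_bdd hD_lip hp' hq'
  refine ⟨SobolevDolbeault.t2Space_Hmax_iff hD_open hD_bdd hD_lip hp' hq',
    SobolevDolbeault.completeSpace_red _
      (SobolevDolbeault.isClosed_Zmax hD_open hD_bdd hD_lip hp' hq' hP),
    SobolevDolbeault.completeSpace_red _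
      (SobolevDolbeault.isClosed_Zmin hD_open hD_bdd hD_lip hp' hq' hP),
    P, SobolevDolbeault.domainPairing_extendsIntegralWedge hp' hq' hP,
    fun B' hB' => SobolevDolbeault.ExtendsIntegralWedge.eq hp' hq' hP hB', ?_⟩
  exact SobolevDolbeault.exists_perfect_pairing (SobolevDolbeault.domainPairing_represents hP)
    SobolevDolbeault.coboundaries_le_cocycles_max SobolevDolbeault.coboundaries_le_cocycles_min
    (SobolevDolbeault.mem_Zmax_iff hD_open hD_bdd hD_lip hp' hq' hP)
    (SobolevDolbeault.mem_Zmin_iff hD_open hD_bdd hD_lip hp' hq' hP)
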